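/- Let $q$ be the number of elements of a finite field $\mathbb F_q$, let $\alpha=(\alpha_1,\dots,\alpha_\ell)$ be a composition of $n$, let $0\le k\le n$, and let $$V_\alpha=\mathbb F_{q^{\alpha_1}}\oplus\dots\oplus\mathbb F_{q^{\alpha_\ell}},\qquad T_\alpha=\mathbb F_{q^{\alpha_1}}^\times\times\dots\times\mathbb F_{q^{\alpha_\ell}}^\times ,$$ where $T_\alpha$ acts on the $\mathbb F_q$-subspaces of $V_\alpha$ by multiplication. **Partitions and weights.** For a partition $\lambda=(\lambda_1\ge\dots\ge\lambda_k\ge 0)$ with $\lambda_1\le n-k$, consider the row echelon form of shape $\lambda$. It is a $k\times n$ matrix whose pivot in row $i$ is a $1$ in column $\lambda_i+k-i+1$; the entries east, north and south of a pivot are $0$, and all other entries are stars (so row $i$ has $\lambda_i$ stars, all to the west of its pivot). Divide the columns into blocks of sizes $\alpha_1,\dots,\alpha_\ell$, labelled from right to left, and let $\beta(\lambda)=(\beta_1,\dots,\beta_\ell)$, where $\beta_r$ is the number of pivots in the $r$-th column block; the rows with their pivot in the $r$-th column block form the $r$-th row block. For $r\le s$ the stars in row block $r$ and column block $s$ form a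 partition $\lambda^{r,s}$ in a $\beta_r\times(\alpha_s-\beta_s)$ box (left-justified after deletion of the pivot columns). With $[a,b]=\sum_{i+j=q-1}a^ib^j=\frac{a^q-b^q}{a-b}$, put $$\mathrm{wt}(\lambda;\alpha,k)=\prod_{1\le r\le s\le \ell}\ \prod_{x\in\lambda^{r,s}}\bigl[t_r^{q^{i(x)+j(x)}},\,t_s^{q^{i(x)+\beta_r}}\bigr]\in\mathbb Z[t_1,\dots,t_\ell],$$ where $i(x)$ and $j(x)$ are the horizontal and vertical distances of the cell $x$ from the bottom-left cell of the box. **Schubert cells.** Fix an $\mathbb F_q$-basis of each $\mathbb F_{q^{\alpha_r}}$, and take as basis of $V_\alpha$ the concatenation of the bases of $\mathbb F_{q^{\alpha_\ell}},\dots,\mathbb F_{q^{\alpha_1}}$, in this order. The Schubert cell $C_\lambda$ is the set of $k$-dimensional subspaces of $V_\alpha$ that are row spaces of matrices of row echelon form of shape $\lambda$ in this basis. **Compatible embeddings.** Regard all the fields $\mathbb F_{q^{\alpha_r}}$ as subfields of one algebraic closure of $\mathbb F_q$, through fixed $\mathbb F_q$-embeddings. Call injective group homomorphisms $\omega_r:\mathbb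 F_{q^{\alpha_r}}^\times\hookrightarrow\mathbb C^\times$ $(1\le r\le\ell)$ *compatible* if $\omega_r$ and $\omega_s$ agree on $\mathbb F_{q^{\alpha_r}}^\times\cap\mathbb F_{q^{\alpha_s}}^\times$ for all $r,s$. **Theorem.** Compatible families $(\omega_r)$ exist. Let $\beta=(\beta_1,\dots,\beta_\ell)$ be a weak composition of $k$ with $\beta_r\le\alpha_r$ for all $r$, and put $$X_\beta=\bigcup_{\lambda:\beta(\lambda)=\beta}C_\lambda,\qquad P_\beta(t_1,\dots,t_\ell)=\sum_{\lambda:\beta(\lambda)=\beta}\mathrm{wt}(\lambda;\alpha,k).$$ 1. The triple $(X_\beta,P_\beta,T_\alpha)$ exhibits the cyclic sieving phenomenon: $X_\beta$ is a finite set stable under $T_\alpha$, and for every compatible family $(\omega_r)$ and every $u=(u_1,\dots,u_\ell)\in T_\alpha$, $$P_\beta(\omega_1(u_1),\dots,\omega_\ell(u_\ell))=\#\{Z\in X_\beta: uZ=Z\}.$$ 2. In the field of fractions of $\mathbb Z[t_1,\dots,t_\ell]$, $$P_\beta=\left(\prod_{r=1}^\ell\prod_{i=0}^{\beta_r-1}\frac{t_r^{q^{\alpha_r}}-t_r^{q^i}}{t_r^{q^{\beta_r}}-t_r^{q^i}}\right)\left(\prod_{1\le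 r<s\le\ell}\ \prod_{j=0}^{\beta_r-1}\ \prod_{i=0}^{\alpha_s-\beta_s-1}\bigl[t_r^{q^{i+j}},t_s^{q^{i+\beta_r}}\bigr]\right).$$ 3. With the $q$-binomial coefficients $\binom{a}{b}_q=\prod_{i=0}^{b-1}\frac{q^a-q^i}{q^b-q^i}$, $$P_\beta(1,\dots,1)=\prod_{r=1}^\ell\binom{\alpha_r}{\beta_r}_q\prod_{1\le r<s\le\ell}q^{\beta_r(\alpha_s-\beta_s)} .$$ Moreover, the sum of these values over all such $\beta$ gives the multi-block $q$-Vandermonde identity $$\binom{n}{k}_q=\sum_{\substack{\beta_1+\dots+\beta_\ell=k\\ 0\le\beta_r\le\alpha_r}}\ \prod_{r=1}^\ell\binom{\alpha_r}{\beta_r}_q\prod_{1\le r<s\le\ell}q^{\beta_r(\alpha_s-\beta_s)} .$$ -/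

import Mathlib

open scoped BigOperators Pointwise

noncomputable section

namespace TorusSieving

/-- The `q`-number `[a, b] = ∑_{i + j = q - 1} a ^ i * b ^ j`, that is
`(a ^ q - b ^ q) / (a - b)`. -/
def qNumber {R : Type*} [CommRing R] (q : ℕ) (a b : R) : R :=
  ∑ i ∈ Finset.range q, a ^ i * b ^ (q - 1 - i)

/-- The `q`-binomial coefficient
`((q^n - 1)(q^n - q)⋯(q^n - q^(k-1))) / ((q^k - 1)(q^k - q)⋯(q^k - q^(k-1)))`. -/
def qBinomial (q n k : ℕ) : ℚ :=
  ∏ i ∈ Finset.range k, ((q : ℚ) ^ n - (q : ℚ) ^ i) / ((q : ℚ) ^ k - (q : ℚ) ^ i)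

open Classical in
/-- The partitions `lam = (lam₁ ≥ ⋯ ≥ lam_k ≥ 0)` that fit in the box `(n - k)^k`. -/
def boxPartitions (n k : ℕ) : Finset (Fin k → ℕ) :=
  (Fintype.piFinset fun _ => Finset.range (n - k + 1)).filter fun lam => Antitone lam

/-- The column of the pivot in row `i`. Rows and columns are counted from `0` here, so this is the
(`1`-based) position `lam_i + k - i + 1` shifted down by one. -/
def pivot {k : ℕ} (lam : Fin k → ℕ) (i : Fin k) : ℕ :=
  lam i + (k - 1 - (i : ℕ))

section Blocks

variable {l : ℕ} (α : Fin l → ℕ) {k : ℕ} (lam : Fin k → ℕ)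

/-- The first column of the block `s`; the column blocks are labelled from right to left, so the
blocks `s' > s` are to the left of the block `s`. -/
def blockStart (s : Fin l) : ℕ :=
  ∑ s' ∈ Finset.Ioi s, α s'

/-- The position, from left to right, of the column number `x` of the block `s`. -/
def column (c : Σ s : Fin l, Fin (α s)) : ℕ :=
  blockStart α c.1 + (c.2 : ℕ)

/-- The rows that have their pivot in the column block `r`. -/
def rowBlock (r : Fin l) : Finset (Fin k) :=
  Finset.univ.filter fun i =>
    blockStart α r ≤ pivot lam i ∧ pivot lam i < blockStart α r + α r

/-- The weak composition `β(lam)`: the number of pivots in each column block. -/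
def pivotComposition (r : Fin l) : ℕ :=
  (rowBlock α lam r).card

open Classical in
/-- The part of the partition `lam^{r,s}` in row `i` (a row of the row block `r`): the number of
stars in row `i` and column block `s`, a star being a place to the left of the pivot of
the row, in a column that is not a pivot column. -/
def starCount (s : Fin l) (i : Fin k) : ℕ :=
  (Finset.univ.filter fun x : Fin (α s) =>
    column α ⟨s, x⟩ < pivot lam i ∧ ∀ i', pivot lam i' ≠ column α ⟨s, x⟩).card

/-- The vertical distance of row `i` from the bottom row of the row block `r`. -/
def height (r : Fin l) (i : Fin k) : ℕ :=
  ((rowBlock α lam r).filter fun i' => i < i').card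

/-- The weight of `lam^{r,s}`: the product over its cells `x` of
`[t_r^(q^(i(x) + j(x))), t_s^(q^(i(x) + β_r))]`, where `i(x)` and `j(x)` are the horizontal and the
vertical distance of `x` from the bottom left cell of the `β_r`-by-`(α_s - β_s)` box. -/
def blockWeight (q : ℕ) (r s : Fin l) : MvPolynomial (Fin l) ℤ :=
  ∏ y ∈ rowBlock α lam r, ∏ i ∈ Finset.range (starCount α lam s y),
    qNumber q (MvPolynomial.X r ^ q ^ (i + height α lam r y))
      (MvPolynomial.X s ^ q ^ (i + pivotComposition α lam r))

/-- The weight `wt(lam; α, k)`. -/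
def weight (q : ℕ) : MvPolynomial (Fin l) ℤ :=
  ∏ r : Fin l, ∏ s ∈ Finset.Ici r, blockWeight α lam q r s

variable (k) in
open Classical in
/-- The partitions `lam` in the box `(n - k)^k`, `n = α₁ + ⋯ + α_l`, with `β(lam) = β`. -/
def partitionsOver (β : Fin l → ℕ) : Finset (Fin k → ℕ) :=
  (boxPartitions (∑ r, α r) k).filter fun lam => pivotComposition α lam = β

variable (k) in
/-- The polynomial `∑_{β(lam) = β} wt(lam; α, k)`. -/
def sievingPolynomial (q : ℕ) (β : Fin l → ℕ) : MvPolynomial (Fin l) ℤ :=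
  ∑ lam ∈ partitionsOver α k β, weight α lam q

end Blocks

section Cells

variable {F : Type*} [Field F] {l : ℕ} {α : Fin l → ℕ} {k : ℕ}

/-- The matrix `M` is a reduced row echelon form of shape `lam`: every pivot is `1`, and the places
east, north and south of a pivot are `0`. -/
def IsEchelon (lam : Fin k → ℕ) (M : Matrix (Fin k) (Σ s : Fin l, Fin (α s)) F) : Prop :=
  ∀ i c, (column α c = pivot lam i → M i c = 1) ∧ (pivot lam i < column α c → M i c = 0) ∧
    ∀ i', i' ≠ i → column α c = pivot lam i' → M i c = 0

variable {E : Fin l → Type*} [∀ r, Field (E r)] [∀ r, Algebra F (E r)]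

/-- The multiplication of `V_α = ⨁_r E_r` by the elements of the torus `T_α = ∏_r (E_r)ˣ` is
`F`-linear. So `T_α` acts on the subspaces `Z` of `V_α` by `u • Z = {u z | z ∈ Z}`. -/
instance torusSMulCommClass : SMulCommClass (∀ r, (E r)ˣ) F (∀ r, E r) where
  smul_comm u c v := by
    funext r
    exact smul_comm (u r) c (v r)

/-- The Schubert cell `C_lam` of the Grassmannian of `k`-dimensional subspaces of
`V_α = ⨁_r E_r`, with respect to the basis of `V_α` that is the concatenation of the bases
`b l, …, b 1` of `E_l, …, E_1`: the row spaces of the row echelon forms of shape `lam`. -/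
def schubertCell (b : ∀ r, Module.Basis (Fin (α r)) F (E r)) (lam : Fin k → ℕ) :
    Set (Submodule F (∀ r, E r)) :=
  {Z | ∃ M : Matrix (Fin k) (Σ s : Fin l, Fin (α s)) F, IsEchelon lam M ∧
    Z = Submodule.span F (Set.range fun i => (Pi.basis b).equivFun.symm (M i))}

variable (k) in
/-- The union of the Schubert cells `C_lam` with `β(lam) = β`. -/
def schubertUnion (b : ∀ r, Module.Basis (Fin (α r)) F (E r)) (β : Fin l → ℕ) :
    Set (Submodule F (∀ r, E r)) :=
  ⋃ lam ∈ partitionsOver α k β, schubertCell b lam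

end Cells

section Sieving

/-- The triple `(X, P, C₁ × ⋯ × C_m)` exhibits the cyclic sieving phenomenon, for the embeddings
`ω i` of the finite cyclic groups `C i` into the multiplicative group of the complex numbers. Here
`X` is a finite subset, stable under `C₁ × ⋯ × C_m`, of a set `Y` with an action of that group. -/
structure ExhibitsCSP {m : ℕ} {C : Fin m → Type*} [∀ i, CommGroup (C i)] [∀ i, Finite (C i)]
    [∀ i, IsCyclic (C i)] {Y : Type*} [MulAction (∀ i, C i) Y] (ω : ∀ i, C i →* ℂˣ)
    (X : Set Y) (P : MvPolynomial (Fin m) ℤ) : Prop where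
  injective : ∀ i, Function.Injective (ω i)
  finite : X.Finite
  stable : ∀ (c : ∀ i, C i), ∀ x ∈ X, c • x ∈ X
  card_fixed : ∀ c : ∀ i, C i,
    MvPolynomial.aeval (fun i => (ω i (c i) : ℂ)) P = ({x ∈ X | c • x = x}.ncard : ℂ)

variable {F : Type*} [Field F] {l : ℕ} {E : Fin l → Type*} [∀ r, Field (E r)]
  [∀ r, Algebra F (E r)]

/-- A choice of embeddings `ω r` of the groups `(E r)ˣ` is compatible if they agree on the elements
that the fields `E r`, seen in one algebraic closure of `F` by the embeddings `ι r`, have in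
common. -/
structure IsCompatible (ι : ∀ r, E r →ₐ[F] AlgebraicClosure F) (ω : ∀ r, (E r)ˣ →* ℂˣ) :
    Prop where
  injective : ∀ r, Function.Injective (ω r)
  agree : ∀ (r s : Fin l) (u : (E r)ˣ) (v : (E s)ˣ),
    ι r (u : E r) = ι s (v : E s) → ω r u = ω s v

end Sieving

end TorusSieving

end

/-! Both sides of the sieving identity split into one factor per block and one factor per pair of
blocks, and these factors agree separately.

Polynomial side. A partition over `β` is a free choice of `β r` pivot columns in each block, and for
`r < s` the block `s` lies to the left of every pivot of block `r`, so `lam^{r,s}` is the full box.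
Hence `sievingPolynomial_eq`: the polynomial is `∏ gaussSum` times the fixed `crossFactor`. A Pascal
recursion gives `gaussSum` its product formula, and parts 2 and 3 follow.

Geometric side. Filter `V` by the sums of the `E s` with `s ≥ r`. The pivots of `Z` in block `r` are
those of the `r`-th graded piece, so `X_β` consists of the `Z` with graded dimensions `β`
(`schubertUnion_eq`), which is stable under the torus. The subspaces fixed by `u` are the submodules
over `A = F[u]`, a finite reduced, hence semisimple, ring. With graded pieces `Y r` prescribed there
are `∏_{r<s} |Hom_A(Y r, E s / Y s)|` of them (`card_submodule_graded`).

Comparison. `A` acts on `E r` through a field of degree `d` over `F`, and `ω r (u r)` returns under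
`q`-th powers after exactly `d` steps. At such a number `gaussSum` is `0` if `d ∤ β r`, and
otherwise the `q ^ d`-binomial that counts the possible `Y r`. The factor of `crossFactor` at `(r,
s)` telescopes to `1` when `u r` and `u s` are not conjugate over `F`, and to the size of the Hom
space when they are; compatibility of `ω` transports conjugacy to `ℂ`. The Vandermonde identity is
the case `u = 1`, summed over `β`. -/

noncomputable section

namespace TorusSieving

/-! ### Telescoping products of `q`-numbers. -/

section QNumbers

variable {R : Type*} [CommRing R]

theorem sub_mul_qNumber (q : ℕ) (a b : R) : (a - b) * qNumber q a b = a ^ q - b ^ q := by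
  rw [qNumber, mul_comm, (Commute.all a b).geom_sum₂_mul]

theorem mul_qNumber_self (q : ℕ) (a : R) : a * qNumber q a a = q * a ^ q := by
  rw [qNumber, Finset.mul_sum, Finset.sum_congr rfl (g := fun _ => a ^ q)]
  · simp
  · intro i hi
    rw [Finset.mem_range] at hi
    rw [← pow_add, ← pow_succ']
    congr 1
    omega

theorem map_qNumber {S : Type*} [CommRing S] (f : R →+* S) (q : ℕ) (a b : R) :
    f (qNumber q a b) = qNumber q (f a) (f b) := by
  simp [qNumber]

theorem sub_mul_prod_qNumber (q : ℕ) (a b : R) (n : ℕ) :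
    (a - b) * ∏ i ∈ Finset.range n, qNumber q (a ^ q ^ i) (b ^ q ^ i) =
      a ^ q ^ n - b ^ q ^ n := by
  induction n with
  | zero => simp
  | succ n ih =>
    rw [Finset.prod_range_succ, ← mul_assoc, ih, sub_mul_qNumber, ← pow_mul, ← pow_mul, ← pow_succ]

/-- The degenerate case `a = b` of the telescoping product; the factor `a` in front avoids the
exponent `q ^ n - 1`. -/
theorem mul_prod_qNumber_self (q : ℕ) (a : R) (n : ℕ) :
    a * ∏ i ∈ Finset.range n, qNumber q (a ^ q ^ i) (a ^ q ^ i) = q ^ n * a ^ q ^ n := by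
  induction n with
  | zero => simp
  | succ n ih =>
    rw [Finset.prod_range_succ, ← mul_assoc, ih, mul_assoc, mul_qNumber_self, ← pow_mul,
      ← pow_succ, ← mul_assoc, pow_succ (q : R)]

end QNumbers

/-- Ranking the elements of `S` is a bijection onto `range S.card`. It turns products over pivots
into products over heights. -/
theorem prod_card_filter_lt {R : Type*} [CommMonoid R] (f : ℕ → R) (S : Finset ℕ) :
    ∏ x ∈ S, f (S.filter (· < x)).card = ∏ j ∈ Finset.range S.card, f j := by
  induction S using Finset.induction_on_max with
  | empty => simp
  | insert a S ha ih =>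
    have haS : a ∉ S := fun h => lt_irrefl _ (ha a h)
    rw [Finset.prod_insert haS, Finset.card_insert_of_notMem haS, Finset.prod_range_succ, mul_comm,
      ← ih]
    congr 1
    · refine Finset.prod_congr rfl fun x hx => ?_
      rw [Finset.filter_insert, if_neg (ha x hx).not_gt]
    · rw [Finset.filter_insert, if_neg (lt_irrefl a), Finset.filter_true_of_mem ha]

/-! ### The weights of a single block and their Pascal recursion. -/

section GaussSum

variable {R : Type*} [CommRing R]

/-- The weight of the pivot set `S` of a block in which there are `b` pivots. -/
def subsetWeight (q b : ℕ) (t : R) (S : Finset ℕ) : R :=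
  ∏ x ∈ S, ∏ i ∈ Finset.range ((Finset.range x).filter (· ∉ S)).card,
    qNumber q (t ^ q ^ (i + (S.filter (· < x)).card)) (t ^ q ^ (i + b))

/-- The sum of the weights of the sets of `b` pivots in a block with `a` columns. -/
def gaussSum (q a b : ℕ) (t : R) : R :=
  ∑ S ∈ (Finset.range a).powersetCard b, subsetWeight q b t S

/-- The shift `x ↦ x + 1`. -/
def shift : ℕ ↪ ℕ := ⟨Nat.succ, Nat.succ_injective⟩

theorem range_succ_eq_insert_map (a : ℕ) :
    Finset.range (a + 1) = insert 0 ((Finset.range a).map shift) := by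
  ext x
  cases x <;> simp [shift]

theorem card_filter_lt_map_shift (S : Finset ℕ) (x : ℕ) :
    ((S.map shift).filter (· < x + 1)).card = (S.filter (· < x)).card := by
  rw [Finset.filter_map, Finset.card_map]
  congr 1
  ext y
  simp [shift]

/-- A pivot in column `0` has no stars and raises every other row by one. As `b` grows by one too,
all exponents of `q` increase by one, which amounts to `t ↦ t ^ q`. -/
theorem subsetWeight_insert_zero (q b : ℕ) (t : R) (S : Finset ℕ) :
    subsetWeight q (b + 1) t (insert 0 (S.map shift)) = subsetWeight q b (t ^ q) S := by
  have h0 : 0 ∉ S.map shift := by simp [shift]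
  rw [subsetWeight, Finset.prod_insert h0, Finset.prod_map, subsetWeight]
  simp only [Finset.range_zero, Finset.filter_empty, Finset.card_empty, Finset.prod_empty, one_mul]
  refine Finset.prod_congr rfl fun x _ => ?_
  have h1 : ((Finset.range (shift x)).filter (· ∉ insert 0 (S.map shift))).card =
      ((Finset.range x).filter (· ∉ S)).card := by
    rw [show shift x = x + 1 from rfl, range_succ_eq_insert_map, Finset.filter_insert]
    simp only [Finset.mem_insert, true_or, not_true_eq_false, if_false]
    rw [Finset.filter_map, Finset.card_map]
    congr 1
    ext y
    simp [shift]
  have h2 : ((insert 0 (S.map shift)).filter (· < shift x)).card =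
      (S.filter (· < x)).card + 1 := by
    rw [show shift x = x + 1 from rfl, Finset.filter_insert, if_pos (Nat.succ_pos x),
      Finset.card_insert_of_notMem (by simp [shift]), card_filter_lt_map_shift]
  rw [h1, h2]
  refine Finset.prod_congr rfl fun i _ => ?_
  rw [← pow_mul, ← pow_mul, ← pow_succ', ← pow_succ']
  rfl

/-- When column `0` is free, every row gains a star there, which accounts for the product over
heights; the other stars move one place to the right, again `t ↦ t ^ q`. -/
theorem subsetWeight_map_shift (q b : ℕ) (t : R) (S : Finset ℕ) :
    subsetWeight q b t (S.map shift) =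
      (∏ j ∈ Finset.range S.card, qNumber q (t ^ q ^ j) (t ^ q ^ b)) *
        subsetWeight q b (t ^ q) S := by
  rw [subsetWeight, Finset.prod_map, subsetWeight,
    ← prod_card_filter_lt (fun j => qNumber q (t ^ q ^ j) (t ^ q ^ b)),
    ← Finset.prod_mul_distrib]
  refine Finset.prod_congr rfl fun x _ => ?_
  have h1 : ((Finset.range (shift x)).filter (· ∉ S.map shift)).card =
      ((Finset.range x).filter (· ∉ S)).card + 1 := by
    rw [show shift x = x + 1 from rfl, range_succ_eq_insert_map, Finset.filter_insert, if_pos,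
      Finset.card_insert_of_notMem (by simp [shift])]
    · rw [Finset.filter_map, Finset.card_map]
      congr 2
      ext y
      simp [shift]
    · simp [shift]
  rw [h1, Finset.prod_range_succ', mul_comm, show shift x = x + 1 from rfl,
    card_filter_lt_map_shift, zero_add, zero_add]
  congr 1
  refine Finset.prod_congr rfl fun i _ => ?_
  rw [← pow_mul, ← pow_mul, ← pow_succ', ← pow_succ', Nat.add_right_comm i 1, Nat.add_right_comm i 1]

theorem gaussSum_zero_right (q a : ℕ) (t : R) : gaussSum q a 0 t = 1 := by
  simp [gaussSum, subsetWeight]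

theorem gaussSum_zero_succ (q b : ℕ) (t : R) : gaussSum q 0 (b + 1) t = 0 := by
  rw [gaussSum, Finset.powersetCard_eq_empty.2 (by simp), Finset.sum_empty]

/-- Pascal recursion: the pivot sets are split according to whether they contain column `0`. -/
theorem gaussSum_succ_succ (q a b : ℕ) (t : R) :
    gaussSum q (a + 1) (b + 1) t = gaussSum q a b (t ^ q) +
      (∏ j ∈ Finset.range (b + 1), qNumber q (t ^ q ^ j) (t ^ q ^ (b + 1))) *
        gaussSum q a (b + 1) (t ^ q) := by
  have h0 : ∀ S : Finset ℕ, 0 ∉ S.map shift := fun S => by simp [shift]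
  rw [gaussSum, range_succ_eq_insert_map, Finset.powersetCard_succ_insert (h0 _),
    Finset.sum_union, add_comm, Finset.sum_image, Finset.powersetCard_map, Finset.powersetCard_map,
    Finset.sum_map, Finset.sum_map, gaussSum, gaussSum, Finset.mul_sum]
  · congr 1
    · exact Finset.sum_congr rfl fun S _ => subsetWeight_insert_zero q b t S
    · refine Finset.sum_congr rfl fun S hS => ?_
      rw [← (Finset.mem_powersetCard.1 hS).2]
      exact subsetWeight_map_shift q _ t S
  · intro S hS T hT h
    have hS' : 0 ∉ S := fun h => h0 _ ((Finset.mem_powersetCard.1 hS).1 h)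
    have hT' : 0 ∉ T := fun h => h0 _ ((Finset.mem_powersetCard.1 hT).1 h)
    rw [← Finset.erase_insert hS', h, Finset.erase_insert hT']
  · rw [Finset.disjoint_left]
    intro S hS hS'
    obtain ⟨T, -, rfl⟩ := Finset.mem_image.1 hS'
    exact h0 _ ((Finset.mem_powersetCard.1 hS).1 (Finset.mem_insert_self _ _))

/-- The denominators are cleared so that the identity holds in every commutative ring, in particular
where they vanish. -/
theorem gaussSum_mul_prod (q a b : ℕ) (t : R) :
    gaussSum q a b t * ∏ j ∈ Finset.range b, (t ^ q ^ b - t ^ q ^ j) =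
      ∏ j ∈ Finset.range b, (t ^ q ^ a - t ^ q ^ j) := by
  induction a generalizing b t with
  | zero =>
    cases b with
    | zero => simp [gaussSum_zero_right]
    | succ b => rw [gaussSum_zero_succ, zero_mul, Finset.prod_range_succ']; simp
  | succ a ih =>
    cases b with
    | zero => simp [gaussSum_zero_right]
    | succ b =>
      have e : ∀ n, (t ^ q) ^ q ^ n = t ^ q ^ (n + 1) := fun n => by rw [← pow_mul, ← pow_succ']
      have h1 := ih b (t ^ q)
      have h2 := ih (b + 1) (t ^ q)
      -- Each `q`-number meets the difference with the same `j` and raises both of its exponents of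
      -- `q` by one.
      have h3 : (∏ j ∈ Finset.range (b + 1), qNumber q (t ^ q ^ j) (t ^ q ^ (b + 1))) *
          ∏ j ∈ Finset.range (b + 1), (t ^ q ^ (b + 1) - t ^ q ^ j) =
          ∏ j ∈ Finset.range (b + 1), (t ^ q ^ (b + 2) - t ^ q ^ (j + 1)) := by
        rw [← Finset.prod_mul_distrib]
        refine Finset.prod_congr rfl fun j _ => ?_
        have := sub_mul_qNumber q (t ^ q ^ j) (t ^ q ^ (b + 1))
        rw [← pow_mul, ← pow_mul, ← pow_succ, ← pow_succ] at this
        linear_combination -this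
      simp only [e] at h1 h2
      have h4 : (∏ j ∈ Finset.range (b + 1), (t ^ q ^ (b + 1) - t ^ q ^ j)) =
          (∏ j ∈ Finset.range b, (t ^ q ^ (b + 1) - t ^ q ^ (j + 1))) *
            (t ^ q ^ (b + 1) - t) := by
        rw [Finset.prod_range_succ']; simp
      have h5 : (∏ j ∈ Finset.range (b + 1), (t ^ q ^ (a + 1) - t ^ q ^ j)) =
          (∏ j ∈ Finset.range b, (t ^ q ^ (a + 1) - t ^ q ^ (j + 1))) *
            (t ^ q ^ (a + 1) - t) := by
        rw [Finset.prod_range_succ']; simp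
      have h6 : (∏ j ∈ Finset.range (b + 1), (t ^ q ^ (a + 1) - t ^ q ^ (j + 1))) =
          (∏ j ∈ Finset.range b, (t ^ q ^ (a + 1) - t ^ q ^ (j + 1))) *
            (t ^ q ^ (a + 1) - t ^ q ^ (b + 1)) := by
        rw [Finset.prod_range_succ]
      rw [gaussSum_succ_succ, h5, add_mul, mul_right_comm, h3]
      nth_rewrite 1 [h4]
      rw [h6] at h2
      linear_combination (t ^ q ^ (b + 1) - t) * h1 + h2

theorem map_gaussSum {S : Type*} [CommRing S] (f : R →+* S) (q a b : ℕ) (t : R) :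
    f (gaussSum q a b t) = gaussSum q a b (f t) := by
  simp [gaussSum, subsetWeight, map_qNumber]

end GaussSum

/-! ### Values at numbers with a finite Frobenius period. -/

section Evaluation

variable {K : Type*} [Field K]

theorem prod_shift_eq_of_periodic {M : Type*} [CommMonoid M] (f : ℕ → M) (m : ℕ)
    (hf : ∀ j, f (j + m) = f j) (n : ℕ) :
    ∏ j ∈ Finset.range m, f (j + n) = ∏ j ∈ Finset.range m, f j := by
  induction n with
  | zero => rfl
  | succ n ih =>
    cases m with
    | zero => rfl
    | succ m =>
      rw [← ih, Finset.prod_range_succ, Finset.prod_range_succ', mul_comm]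
      rw [show m + (n + 1) = n + (m + 1) by omega, hf, zero_add, mul_comm]
      congr 1
      exact Finset.prod_congr rfl fun j _ => by rw [show j + 1 + n = j + (n + 1) by omega]

/-- The powers `w ^ q ^ i` have the exact period `d`. -/
def HasFrobeniusPeriod (q : ℕ) (w : K) (d : ℕ) : Prop :=
  ∀ i j, w ^ q ^ i = w ^ q ^ j ↔ i ≡ j [MOD d]

theorem HasFrobeniusPeriod.pow_eq_self {q : ℕ} {w : K} {d : ℕ} (h : HasFrobeniusPeriod q w d)
    {n : ℕ} (hn : d ∣ n) : w ^ q ^ n = w := by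
  conv_rhs => rw [← pow_one w, ← pow_zero q]
  exact (h n 0).2 ((Nat.modEq_zero_iff_dvd).2 hn)

theorem HasFrobeniusPeriod.pow_add_eq {q : ℕ} {w : K} {d : ℕ} (h : HasFrobeniusPeriod q w d)
    {n : ℕ} (hn : d ∣ n) (i : ℕ) : w ^ q ^ (i + n) = w ^ q ^ i := by
  rw [add_comm, pow_add, pow_mul, h.pow_eq_self hn]

theorem card_filter_modEq_range_mul (d m c : ℕ) (hd : 0 < d) :
    ((Finset.range (d * m)).filter fun j => j ≡ c [MOD d]).card = m := by
  have := Nat.count_modEq_card (d * m) hd c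
  rw [Nat.count_eq_card_filter_range] at this
  rw [this]
  simp [hd]

/-- For fixed `j` the inner product telescopes to a quotient of equal differences, because `n` is a
multiple of the period. The exceptions are the `b` indices `j ≡ c`, where the differences vanish and
the degenerate case yields `q ^ n`. -/
theorem prod_prod_qNumber_of_conjugate {q : ℕ} {v w : K} {d b n c : ℕ} (hd : 0 < d)
    (hv0 : v ≠ 0) (hv : HasFrobeniusPeriod q v d) (hw : w = v ^ q ^ c) (hn : d ∣ n) :
    ∏ j ∈ Finset.range (d * b), ∏ i ∈ Finset.range n,
      qNumber q (v ^ q ^ (i + j)) (w ^ q ^ (i + d * b)) = ((q : K) ^ n) ^ b := by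
  classical
  have key : ∀ j ∈ Finset.range (d * b), ∏ i ∈ Finset.range n,
      qNumber q (v ^ q ^ (i + j)) (w ^ q ^ (i + d * b)) =
        if j ≡ c [MOD d] then (q : K) ^ n else 1 := by
    intro j _
    have h1 : ∀ i, v ^ q ^ (i + j) = (v ^ q ^ j) ^ q ^ i := fun i => by
      rw [← pow_mul, ← pow_add, add_comm]
    have h2 : ∀ i, w ^ q ^ (i + d * b) = (v ^ q ^ c) ^ q ^ i := fun i => by
      rw [hw, ← pow_mul, ← pow_add, ← pow_mul, ← pow_add, ← add_assoc,
        hv.pow_add_eq (Dvd.intro _ rfl)]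
    have h3 : ∀ j, (v ^ q ^ j) ^ q ^ n = v ^ q ^ j := fun j => by
      rw [← pow_mul, ← pow_add, hv.pow_add_eq hn]
    simp only [h1, h2]
    split_ifs with h
    · rw [(hv j c).2 h]
      apply mul_left_cancel₀ (pow_ne_zero (q ^ c) hv0)
      rw [mul_prod_qNumber_self, h3, mul_comm]
    · have hne : v ^ q ^ j - v ^ q ^ c ≠ 0 := sub_ne_zero.2 fun e => h ((hv j c).1 e)
      apply mul_left_cancel₀ hne
      rw [sub_mul_prod_qNumber, h3, h3, mul_one]
  rw [Finset.prod_congr rfl key, Finset.prod_ite, Finset.prod_const_one, mul_one,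
    Finset.prod_const, card_filter_modEq_range_mul d b c hd]

/-- Here `d` need not divide `n`, so a single inner product need not be `1`. Over all `j < b`,
however, the numerators are the denominators shifted by `n`, and the range consists of full periods
of `v`. -/
theorem prod_prod_qNumber_of_not_conjugate {q : ℕ} {v w : K} {d e b n : ℕ} (he : 0 < e)
    (hv : HasFrobeniusPeriod q v d) (hw : HasFrobeniusPeriod q w e)
    (hvw : ∀ c, w ≠ v ^ q ^ c) (hb : d ∣ b) (hn : e ∣ n) :
    ∏ j ∈ Finset.range b, ∏ i ∈ Finset.range n,
      qNumber q (v ^ q ^ (i + j)) (w ^ q ^ (i + b)) = 1 := by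
  have hne : ∀ j, v ^ q ^ j - w ^ q ^ b ≠ 0 := by
    intro j h
    rw [sub_eq_zero] at h
    -- Raising to the power `q ^ f` undoes `q ^ b` on `w`, since `b + f = e * b` is a multiple of
    -- the period.
    obtain ⟨f, hf⟩ : ∃ f, e ∣ b + f := ⟨(e - 1) * b, ⟨b, by
      obtain ⟨e, rfl⟩ : ∃ e', e = e' + 1 := ⟨e - 1, by omega⟩
      simp; ring⟩⟩
    apply hvw (j + f)
    rw [pow_add, pow_mul, h, ← pow_mul, ← pow_add, hw.pow_eq_self hf]
  have h0 : ∏ j ∈ Finset.range b, (v ^ q ^ j - w ^ q ^ b) ≠ 0 :=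
    Finset.prod_ne_zero_iff.2 fun j _ => hne j
  apply mul_left_cancel₀ h0
  rw [← Finset.prod_mul_distrib, mul_one]
  rw [← prod_shift_eq_of_periodic (fun j => v ^ q ^ j - w ^ q ^ b) b
    (fun j => by simp only [hv.pow_add_eq hb]) n]
  refine Finset.prod_congr rfl fun j _ => ?_
  have h1 : ∀ i, v ^ q ^ (i + j) = (v ^ q ^ j) ^ q ^ i := fun i => by
    rw [← pow_mul, ← pow_add, add_comm]
  have h2 : ∀ i, w ^ q ^ (i + b) = (w ^ q ^ b) ^ q ^ i := fun i => by
    rw [← pow_mul, ← pow_add, add_comm]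
  simp only [h1, h2]
  rw [sub_mul_prod_qNumber, ← h1, ← h2, add_comm n j, add_comm n b, hw.pow_add_eq hn]

-- The value of the cofactor at the root `w` is the derivative of the difference there; multiplying
-- by `w` restores the exponent `q ^ a`.
open Polynomial in
theorem exists_pow_sub_pow_eq_mul {q : ℕ} (hq : 0 < q) (w : K) (i a : ℕ)
    (h : w ^ q ^ i = w ^ q ^ a) : ∃ g : K[X], X ^ q ^ a - X ^ q ^ i = (X - C w) * g ∧
      w * g.eval w = ((q : K) ^ a - (q : K) ^ i) * w ^ q ^ a := by
  obtain ⟨g, hg⟩ : X - C w ∣ (X ^ q ^ a - X ^ q ^ i : K[X]) := by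
    rw [dvd_iff_isRoot]; simp [h]
  refine ⟨g, hg, ?_⟩
  have := congrArg (fun p => w * (derivative p).eval w) hg
  simp only [derivative_sub, derivative_X_pow, derivative_mul, eval_sub, eval_mul, eval_add,
    eval_pow, eval_X, eval_C, derivative_X, derivative_C, sub_self, zero_mul, add_zero, sub_zero,
    one_mul, map_natCast, eval_natCast] at this
  rw [← this]
  have e : ∀ n, w * w ^ (q ^ n - 1) = w ^ q ^ n := fun n => by
    rw [← pow_succ', Nat.sub_add_cancel (Nat.pow_pos hq)]
  push_cast
  rw [mul_sub, mul_left_comm, e, mul_left_comm, e, h]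
  ring

theorem card_filter_modEq_range_le (d b : ℕ) (hd : 0 < d) (hb : ¬ d ∣ b) :
    ((Finset.range b).filter fun j => j ≡ b [MOD d]).card <
      ((Finset.range b).filter fun j => j ≡ 0 [MOD d]).card := by
  have h1 := Nat.count_modEq_card b hd b
  have h2 := Nat.count_modEq_card b hd 0
  rw [Nat.count_eq_card_filter_range] at h1 h2
  rw [h1, h2, if_neg (lt_irrefl _), Nat.zero_mod, if_pos]
  · omega
  · exact Nat.pos_of_ne_zero fun h => hb (Nat.dvd_of_mod_eq_zero h)

theorem prod_filter_modEq_zero {M : Type*} [CommMonoid M] (f : ℕ → M) (d b : ℕ) (hd : 0 < d) :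
    ∏ j ∈ (Finset.range (d * b)).filter (fun j => j ≡ 0 [MOD d]), f j =
      ∏ j ∈ Finset.range b, f (d * j) := by
  symm
  refine Finset.prod_nbij (fun j => d * j) ?_ ?_ ?_ fun _ _ => rfl
  · intro j hj
    simp only [Finset.mem_range, Finset.mem_filter] at hj ⊢
    exact ⟨Nat.mul_lt_mul_of_pos_left hj hd, Nat.modEq_zero_iff_dvd.2 (Dvd.intro _ rfl)⟩
  · intro i _ j _ h
    exact Nat.eq_of_mul_eq_mul_left hd h
  · intro j hj
    simp only [Finset.coe_filter, Finset.mem_range, Set.mem_ofPred_eq, Nat.modEq_zero_iff_dvd] at hj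
    obtain ⟨hj, i, rfl⟩ := hj
    exact ⟨i, by simpa using Nat.lt_of_mul_lt_mul_left hj, rfl⟩

open Polynomial in
theorem exists_pow_sub_pow_factor {q : ℕ} (hq : 0 < q) {w : K} {d : ℕ}
    (hw : HasFrobeniusPeriod q w d) (i a : ℕ) : ∃ g : K[X],
      X ^ q ^ a - X ^ q ^ i = (X - C w) ^ (if i ≡ a [MOD d] then 1 else 0) * g ∧
      (¬ i ≡ a [MOD d] → g.eval w = w ^ q ^ a - w ^ q ^ i) ∧
      (i ≡ a [MOD d] → w * g.eval w = ((q : K) ^ a - (q : K) ^ i) * w ^ q ^ a) := by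
  by_cases h : i ≡ a [MOD d]
  · obtain ⟨g, hg, hg'⟩ := exists_pow_sub_pow_eq_mul hq w i a ((hw i a).2 h)
    exact ⟨g, by simp [h, hg], fun h' => (h' h).elim, fun _ => hg'⟩
  · exact ⟨_, by rw [if_neg h, pow_zero, one_mul], fun _ => by simp, fun h' => (h h').elim⟩

-- L'Hôpital's rule in polynomial form: on both sides of `gaussSum_mul_prod` the powers of `X - C w`
-- are split off, and the cofactors have known values at `w`. Characteristic zero makes `q ^ b - q ^
-- j` nonzero for `j < b`.
open Polynomial in
theorem exists_gaussSum_factor {q : ℕ} (hq : 1 < q) [CharZero K] {w : K} (hw0 : w ≠ 0) {d : ℕ}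
    (hw : HasFrobeniusPeriod q w d) (a b : ℕ) : ∃ g h : ℕ → K[X],
      gaussSum q a b (X : K[X]) *
          (X - C w) ^ ((Finset.range b).filter fun j => j ≡ b [MOD d]).card *
          ∏ j ∈ Finset.range b, g j =
        (X - C w) ^ ((Finset.range b).filter fun j => j ≡ a [MOD d]).card *
          ∏ j ∈ Finset.range b, h j ∧
      (∀ j, ¬ j ≡ b [MOD d] → (g j).eval w = w ^ q ^ b - w ^ q ^ j) ∧
      (∀ j, j ≡ b [MOD d] → w * (g j).eval w = ((q : K) ^ b - (q : K) ^ j) * w ^ q ^ b) ∧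
      (∀ j, ¬ j ≡ a [MOD d] → (h j).eval w = w ^ q ^ a - w ^ q ^ j) ∧
      (∀ j, j ≡ a [MOD d] → w * (h j).eval w = ((q : K) ^ a - (q : K) ^ j) * w ^ q ^ a) ∧
      (∀ j ∈ Finset.range b, (g j).eval w ≠ 0) := by
  choose g hg1 hg2 hg3 using fun j => exists_pow_sub_pow_factor (by omega : 0 < q) hw j b
  choose h hh1 hh2 hh3 using fun j => exists_pow_sub_pow_factor (by omega : 0 < q) hw j a
  refine ⟨g, h, ?_, hg2, hg3, hh2, hh3, ?_⟩
  · have := gaussSum_mul_prod q a b (X : K[X])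
    simp only [hg1, hh1, Finset.prod_mul_distrib, Finset.prod_pow_eq_pow_sum] at this
    rw [Finset.card_filter, Finset.card_filter, mul_assoc]
    exact this
  · intro j hj
    rw [Finset.mem_range] at hj
    by_cases hjb : j ≡ b [MOD d]
    · intro h0
      have := hg3 j hjb
      rw [h0, mul_zero, eq_comm, mul_eq_zero, sub_eq_zero] at this
      rcases this with this | this
      · have h' : q ^ b = q ^ j := by exact_mod_cast this
        exact hj.ne' (Nat.pow_right_injective hq h')
      · exact pow_ne_zero _ hw0 this
    · rw [hg2 j hjb, sub_ne_zero]
      exact fun e => hjb ((hw b j).1 e).symm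

-- At `w` the numerator vanishes to the order `#{j < b | j ≡ 0}`, the denominator only to the
-- smaller order `#{j < b | j ≡ b}`.
open Polynomial in
theorem gaussSum_eq_zero_of_not_dvd {q : ℕ} (hq : 1 < q) [CharZero K] {w : K} (hw0 : w ≠ 0)
    {d : ℕ} (hd : 0 < d) (hw : HasFrobeniusPeriod q w d) {a b : ℕ} (ha : d ∣ a) (hb : ¬ d ∣ b) :
    gaussSum q a b w = 0 := by
  obtain ⟨g, h, e, -, -, -, -, hg⟩ := exists_gaussSum_factor hq hw0 hw a b
  have ha' : ∀ j, j ≡ a [MOD d] ↔ j ≡ 0 [MOD d] := fun j =>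
    ⟨fun h => h.trans (Nat.modEq_zero_iff_dvd.2 ha),
      fun h => h.trans (Nat.modEq_zero_iff_dvd.2 ha).symm⟩
  simp only [ha'] at e
  obtain ⟨m, hm⟩ := Nat.exists_eq_add_of_lt (card_filter_modEq_range_le d b hd hb)
  rw [hm, mul_comm (gaussSum _ _ _ _), mul_assoc, add_assoc, pow_add, mul_assoc] at e
  have e' := mul_left_cancel₀ (pow_ne_zero _ (X_sub_C_ne_zero w)) e
  have e'' := congrArg (eval w) e'
  rw [eval_mul, eval_prod, eval_mul, eval_pow, eval_sub, eval_X, eval_C, sub_self,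
    zero_pow (Nat.succ_ne_zero m), zero_mul, mul_eq_zero] at e''
  have h1 : eval w (gaussSum q a b (X : K[X])) = gaussSum q a b w := by
    have := map_gaussSum (evalRingHom w) q a b X
    simpa using this
  rw [← h1]
  exact e''.resolve_right (Finset.prod_ne_zero_iff.2 hg)

-- Numerator and denominator vanish at `w` to the same order. The factors with `d ∤ j` cancel, as
-- both `d * a` and `d * b` are multiples of the period; those with `d ∣ j` contribute the ratios of
-- derivatives, which form the `q ^ d`-binomial.
open Polynomial in
theorem gaussSum_mul_mul {q : ℕ} (hq : 1 < q) [CharZero K] {w : K} (hw0 : w ≠ 0)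
    {d : ℕ} (hd : 0 < d) (hw : HasFrobeniusPeriod q w d) (a b : ℕ) :
    gaussSum q (d * a) (d * b) w = (qBinomial (q ^ d) a b : ℚ) := by
  classical
  obtain ⟨g, h, e, hg1, hg2, hh1, hh2, hg⟩ := exists_gaussSum_factor hq hw0 hw (d * a) (d * b)
  have ha' : ∀ m j, j ≡ d * m [MOD d] ↔ j ≡ 0 [MOD d] := fun m j =>
    ⟨fun h => h.trans (Nat.modEq_zero_iff_dvd.2 (Dvd.intro _ rfl)),
      fun h => h.trans (Nat.modEq_zero_iff_dvd.2 (Dvd.intro _ rfl)).symm⟩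
  have hp : ∀ m, w ^ q ^ (d * m) = w := fun m => hw.pow_eq_self (Dvd.intro _ rfl)
  simp only [ha', hp] at e hg1 hg2 hh1 hh2
  rw [mul_comm (gaussSum _ _ _ _), mul_assoc] at e
  have e' := mul_left_cancel₀ (pow_ne_zero _ (X_sub_C_ne_zero w)) e
  have e'' := congrArg (eval w) e'
  rw [eval_mul, eval_prod, eval_prod] at e''
  have h1 : eval w (gaussSum q (d * a) (d * b) (X : K[X])) = gaussSum q (d * a) (d * b) w := by
    have := map_gaussSum (evalRingHom w) q (d * a) (d * b) X
    simpa using this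
  rw [h1] at e''
  rw [eq_div_of_mul_eq (Finset.prod_ne_zero_iff.2 hg) e'', ← Finset.prod_div_distrib, qBinomial]
  push_cast
  have h2 := fun j => prod_filter_modEq_zero
    (fun j => ((q : K) ^ (d * a) - (q : K) ^ j) / ((q : K) ^ (d * b) - (q : K) ^ j)) d j hd
  simp only [← pow_mul]
  rw [← h2, Finset.prod_filter]
  refine Finset.prod_congr rfl fun j hj => ?_
  split_ifs with hj0
  · congr 1
    · apply mul_left_cancel₀ hw0
      rw [hh2 j hj0, mul_comm]
    · apply mul_left_cancel₀ hw0
      rw [hg2 j hj0, mul_comm]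
  · rw [hh1 j hj0, ← hg1 j hj0, div_self (hg j hj)]

theorem hasFrobeniusPeriod_one (q : ℕ) : HasFrobeniusPeriod q (1 : K) 1 := fun i j => by
  simp [Nat.modEq_one]

theorem gaussSum_one {q : ℕ} (hq : 1 < q) [CharZero K] (a b : ℕ) :
    gaussSum q a b (1 : K) = (qBinomial q a b : ℚ) := by
  have := gaussSum_mul_mul hq one_ne_zero one_pos (hasFrobeniusPeriod_one (K := K) q) a b
  rwa [one_mul, one_mul, pow_one] at this

end Evaluation

/-! ### Columns, pivots, and partitions encoded by pivot sets. -/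

section Columns

variable {l : ℕ} (α : Fin l → ℕ)

theorem blockStart_add_le_blockStart {r s : Fin l} (h : s < r) :
    blockStart α r + α r ≤ blockStart α s := by
  rw [blockStart, add_comm, ← Finset.sum_insert (by simp), blockStart]
  refine Finset.sum_le_sum_of_subset fun x hx => ?_
  rcases Finset.mem_insert.1 hx with rfl | hx
  · simpa using h
  · simp only [Finset.mem_Ioi] at hx ⊢
    exact h.trans hx

theorem blockStart_add_le_sum (r : Fin l) : blockStart α r + α r ≤ ∑ s, α s := by
  rw [blockStart, add_comm, ← Finset.sum_insert (by simp)]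
  exact Finset.sum_le_sum_of_subset (Finset.subset_univ _)

theorem block_unique {r s : Fin l} {x y : ℕ} (hx : x < α r) (hy : y < α s)
    (h : blockStart α r + x = blockStart α s + y) : r = s ∧ x = y := by
  rcases lt_trichotomy r s with hrs | rfl | hrs
  · have := blockStart_add_le_blockStart α hrs
    omega
  · exact ⟨rfl, by omega⟩
  · have := blockStart_add_le_blockStart α hrs
    omega

theorem column_injective : Function.Injective (column α) := by
  rintro ⟨r, x⟩ ⟨s, y⟩ h
  obtain ⟨rfl, hxy⟩ := block_unique α x.2 y.2 h
  rw [Fin.ext hxy]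

theorem column_lt_sum (c : Σ s : Fin l, Fin (α s)) : column α c < ∑ r, α r :=
  lt_of_lt_of_le (Nat.add_lt_add_left c.2.2 _) (blockStart_add_le_sum α c.1)

theorem exists_column_eq {m : ℕ} (hm : m < ∑ r, α r) : ∃ c, column α c = m := by
  have hinj : Function.Injective
      fun c => (⟨column α c, column_lt_sum α c⟩ : Fin (∑ r, α r)) := fun c c' h =>
    column_injective α (by simpa using h)
  have := ((Fintype.bijective_iff_injective_and_card _).2 ⟨hinj, by simp⟩).2 ⟨m, hm⟩
  obtain ⟨c, hc⟩ := this
  exact ⟨c, by simpa using hc⟩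

theorem column_lt_column_of_lt {c c' : Σ s : Fin l, Fin (α s)} (h : c'.1 < c.1) :
    column α c < column α c' := by
  have := blockStart_add_le_blockStart α h
  have := c.2.2
  unfold column
  omega

end Columns

section Pivots

variable {k : ℕ}

theorem pivot_strictAnti {lam : Fin k → ℕ} (h : Antitone lam) : StrictAnti (pivot lam) := by
  intro i j hij
  have h1 := h hij.le
  have h2 := j.2
  rw [Fin.lt_def] at hij
  unfold pivot
  omega

theorem mem_boxPartitions {n : ℕ} {lam : Fin k → ℕ} :
    lam ∈ boxPartitions n k ↔ (∀ i, lam i ≤ n - k) ∧ Antitone lam := by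
  simp [boxPartitions]

theorem pivot_lt {n : ℕ} (hk : k ≤ n) {lam : Fin k → ℕ} (h : lam ∈ boxPartitions n k)
    (i : Fin k) : pivot lam i < n := by
  have h1 := (mem_boxPartitions.1 h).1 i
  have h2 := i.2
  unfold pivot
  omega

theorem pivot_injOn : Set.InjOn (fun lam : Fin k → ℕ => Set.range (pivot lam))
    {lam | Antitone lam} := by
  intro lam hlam mu hmu h
  have e := ((pivot_strictAnti hlam).range_inj (pivot_strictAnti hmu)).1 h
  funext i
  have := congrFun e i
  simpa [pivot] using this

theorem strictMono_add_le {f : Fin k → ℕ} (hf : StrictMono f) (d : ℕ) (i j : Fin k)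
    (h : (i : ℕ) + d = j) : f i + d ≤ f j := by
  induction d generalizing j with
  | zero => rw [Fin.ext (a := i) (b := j) h, add_zero]
  | succ d ih =>
    have h1 := ih ⟨i + d, by omega⟩ rfl
    have h2 : f ⟨i + d, by omega⟩ < f j := hf (by rw [Fin.lt_def]; simp; omega)
    omega

/-- The pivots are the elements of `T` in decreasing order. Strict monotonicity of the increasing
enumeration shows that the subtraction of `k - 1 - i` is not truncated, that the parts decrease
weakly, and that they are at most `n - k`. -/
theorem exists_boxPartition {n : ℕ} (T : Finset ℕ) (hT : T ⊆ Finset.range n) (hk : T.card = k) :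
    ∃ lam ∈ boxPartitions n k, Set.range (pivot lam) = T := by
  set f := T.orderEmbOfFin hk with hf
  have hmono : StrictMono f := f.strictMono
  have hkn : k ≤ n := by
    rw [← hk]; simpa using Finset.card_le_card hT
  have hlt : ∀ j, f j < n := fun j => Finset.mem_range.1 (hT (T.orderEmbOfFin_mem hk j))
  have hlow : ∀ j : Fin k, (j : ℕ) ≤ f j := fun j => by
    have := strictMono_add_le hmono j ⟨0, Nat.zero_lt_of_lt j.2⟩ j (by simp)
    omega
  have hpiv : ∀ i : Fin k, f (Fin.rev i) - (k - 1 - i) + (k - 1 - i) = f (Fin.rev i) := fun i => by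
    have := hlow (Fin.rev i)
    rw [Fin.val_rev] at this
    omega
  refine ⟨fun i => f (Fin.rev i) - (k - 1 - i), mem_boxPartitions.2 ⟨fun i => ?_, ?_⟩, ?_⟩
  · have hi := i.2
    have h1 := strictMono_add_le hmono i (Fin.rev i) ⟨k - 1, by omega⟩
      (by rw [Fin.val_rev]; simp only; omega)
    have h2 := hlt ⟨k - 1, by omega⟩
    omega
  · intro i j hij
    rw [Fin.le_def] at hij
    have h1 := strictMono_add_le hmono (j - i) (Fin.rev j) (Fin.rev i)
      (by rw [Fin.val_rev, Fin.val_rev]; omega)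
    have := i.2
    have := j.2
    simp only
    omega
  · have : pivot (fun i : Fin k => f (Fin.rev i) - (k - 1 - i)) = f ∘ Fin.rev := funext hpiv
    rw [this, Set.range_comp, Fin.rev_surjective.range_eq, Set.image_univ, hf,
      Finset.range_orderEmbOfFin]

end Pivots

/-! ### Factorisation of the sieving polynomial over the blocks. -/

section PivotSets

variable {l : ℕ} (α : Fin l → ℕ) {k : ℕ} (lam : Fin k → ℕ)

open Classical in
/-- The positions in the column block `r` of the pivot columns. -/
def blockPivots (r : Fin l) : Finset ℕ :=
  (Finset.range (α r)).filter fun x => ∃ i, pivot lam i = blockStart α r + x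

variable {α lam}

theorem mem_blockPivots {r : Fin l} {x : ℕ} :
    x ∈ blockPivots α lam r ↔ x < α r ∧ ∃ i, pivot lam i = blockStart α r + x := by
  simp [blockPivots]

theorem mem_rowBlock {r : Fin l} {i : Fin k} :
    i ∈ rowBlock α lam r ↔
      blockStart α r ≤ pivot lam i ∧ pivot lam i < blockStart α r + α r := by
  simp [rowBlock]

theorem blockPivots_subset (r : Fin l) : blockPivots α lam r ⊆ Finset.range (α r) :=
  Finset.filter_subset _ _

theorem sub_mem_blockPivots {r : Fin l} {i : Fin k} (hi : i ∈ rowBlock α lam r) :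
    pivot lam i - blockStart α r ∈ blockPivots α lam r := by
  rw [mem_rowBlock] at hi
  exact mem_blockPivots.2 ⟨by omega, i, by omega⟩

theorem exists_mem_rowBlock {r : Fin l} {x : ℕ} (hx : x ∈ blockPivots α lam r) :
    ∃ i ∈ rowBlock α lam r, pivot lam i - blockStart α r = x := by
  obtain ⟨hx, i, hi⟩ := mem_blockPivots.1 hx
  exact ⟨i, mem_rowBlock.2 ⟨by omega, by omega⟩, by omega⟩

theorem sub_injOn_rowBlock (hlam : Antitone lam) (r : Fin l) :
    Set.InjOn (fun i => pivot lam i - blockStart α r) (rowBlock α lam r) := by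
  intro i hi j hj h
  have hi := mem_rowBlock.1 (Finset.mem_coe.1 hi)
  have hj := mem_rowBlock.1 (Finset.mem_coe.1 hj)
  exact (pivot_strictAnti hlam).injective (by simp only at h; omega)

theorem card_blockPivots (hlam : Antitone lam) (r : Fin l) :
    (blockPivots α lam r).card = pivotComposition α lam r := by
  symm
  exact Finset.card_nbij (fun i => pivot lam i - blockStart α r)
    (fun _ hi => sub_mem_blockPivots hi) (sub_injOn_rowBlock hlam r)
    (fun _ hx => exists_mem_rowBlock hx)

theorem prod_rowBlock {M : Type*} [CommMonoid M] (hlam : Antitone lam) (r : Fin l) (f : ℕ → M) :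
    ∏ i ∈ rowBlock α lam r, f (pivot lam i - blockStart α r) =
      ∏ x ∈ blockPivots α lam r, f x :=
  Finset.prod_nbij (fun i => pivot lam i - blockStart α r)
    (fun _ hi => sub_mem_blockPivots hi) (sub_injOn_rowBlock hlam r)
    (fun _ hx => exists_mem_rowBlock hx) (fun _ _ => rfl)

theorem height_eq (hlam : Antitone lam) {r : Fin l} {i : Fin k} (hi : i ∈ rowBlock α lam r) :
    height α lam r i =
      ((blockPivots α lam r).filter (· < pivot lam i - blockStart α r)).card := by
  have hi' := mem_rowBlock.1 hi
  refine Finset.card_nbij (fun i => pivot lam i - blockStart α r) ?_ ?_ ?_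
  · intro j hj
    obtain ⟨hj, hij⟩ := Finset.mem_filter.1 hj
    refine Finset.mem_filter.2 ⟨sub_mem_blockPivots hj, ?_⟩
    have h1 : pivot lam j < pivot lam i := pivot_strictAnti hlam hij
    have h2 := mem_rowBlock.1 hj
    simp only
    omega
  · exact (sub_injOn_rowBlock hlam r).mono (by
      exact_mod_cast Finset.filter_subset _ _)
  · intro x hx
    obtain ⟨hx, hxi⟩ := Finset.mem_filter.1 (Finset.mem_coe.1 hx)
    obtain ⟨j, hj, rfl⟩ := exists_mem_rowBlock hx
    refine ⟨j, Finset.mem_coe.2 (Finset.mem_filter.2 ⟨hj, ?_⟩), rfl⟩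
    exact (pivot_strictAnti hlam).lt_iff_gt.1 (by omega)

theorem starCount_eq_card {s : Fin l} {i : Fin k} :
    starCount α lam s i = ((Finset.range (α s)).filter fun x =>
      blockStart α s + x < pivot lam i ∧ x ∉ blockPivots α lam s).card := by
  refine Finset.card_nbij (fun x : Fin (α s) => (x : ℕ)) ?_ ?_ ?_
  · intro x hx
    obtain ⟨h1, h2⟩ := (Finset.mem_filter.1 hx).2
    exact Finset.mem_filter.2 ⟨Finset.mem_range.2 x.2, h1, fun h => by
      obtain ⟨-, j, hj⟩ := mem_blockPivots.1 h
      exact h2 j hj⟩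
  · exact fun x _ y _ h => Fin.ext h
  · intro x hx
    obtain ⟨h0, h1, h2⟩ := Finset.mem_filter.1 (Finset.mem_coe.1 hx)
    rw [Finset.mem_range] at h0
    exact ⟨⟨x, h0⟩, Finset.mem_coe.2 (Finset.mem_filter.2 ⟨Finset.mem_univ _, h1, fun j hj =>
      h2 (mem_blockPivots.2 ⟨h0, j, hj⟩)⟩), rfl⟩

theorem starCount_self {r : Fin l} {i : Fin k} (hi : i ∈ rowBlock α lam r) :
    starCount α lam r i =
      ((Finset.range (pivot lam i - blockStart α r)).filter (· ∉ blockPivots α lam r)).card := by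
  rw [starCount_eq_card]
  have := mem_rowBlock.1 hi
  congr 1
  ext x
  simp only [Finset.mem_filter, Finset.mem_range]
  constructor
  · rintro ⟨h1, h2, h3⟩
    exact ⟨by omega, h3⟩
  · rintro ⟨h1, h2⟩
    exact ⟨by omega, by omega, h2⟩

/-- Block `s` lies entirely to the left of block `r`, so each of its non-pivot columns carries a
star. -/
theorem starCount_of_lt (hlam : Antitone lam) {r s : Fin l} (hrs : r < s) {i : Fin k}
    (hi : i ∈ rowBlock α lam r) :
    starCount α lam s i = α s - pivotComposition α lam s := by
  rw [starCount_eq_card, ← card_blockPivots hlam]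
  conv_rhs => rw [← Finset.card_range (α s)]
  rw [← Finset.card_sdiff_of_subset (blockPivots_subset s)]
  have h1 := mem_rowBlock.1 hi
  have h2 := blockStart_add_le_blockStart α hrs
  congr 1
  ext x
  simp only [Finset.mem_filter, Finset.mem_range, Finset.mem_sdiff]
  exact ⟨fun h => ⟨h.1, h.2.2⟩, fun h => ⟨h.1, by omega, h.2⟩⟩

theorem blockWeight_self (hlam : Antitone lam) (q : ℕ) (r : Fin l) :
    blockWeight α lam q r r =
      subsetWeight q (pivotComposition α lam r) (MvPolynomial.X r) (blockPivots α lam r) := by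
  rw [blockWeight, subsetWeight, ← prod_rowBlock hlam]
  refine Finset.prod_congr rfl fun i hi => ?_
  rw [starCount_self hi, height_eq hlam hi]

theorem blockWeight_of_lt (hlam : Antitone lam) (q : ℕ) {r s : Fin l} (hrs : r < s) :
    blockWeight α lam q r s = ∏ j ∈ Finset.range (pivotComposition α lam r),
      ∏ i ∈ Finset.range (α s - pivotComposition α lam s),
        qNumber q (MvPolynomial.X r ^ q ^ (i + j))
          (MvPolynomial.X s ^ q ^ (i + pivotComposition α lam r)) := by
  conv_rhs => rw [← card_blockPivots hlam r]
  rw [← prod_card_filter_lt (fun j => ∏ i ∈ Finset.range (α s - pivotComposition α lam s),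
        qNumber q (MvPolynomial.X r ^ q ^ (i + j))
          (MvPolynomial.X s ^ q ^ (i + (blockPivots α lam r).card))), ← prod_rowBlock hlam,
    blockWeight]
  refine Finset.prod_congr rfl fun i hi => ?_
  rw [starCount_of_lt hlam hrs hi, height_eq hlam hi, card_blockPivots hlam]

/-- The product of the weights of the full boxes `lam^{r,s}`, `r < s`. -/
def crossFactor {R : Type*} [CommRing R] (q : ℕ) (α β : Fin l → ℕ) (t : Fin l → R) : R :=
  ∏ r, ∏ s ∈ Finset.Ioi r, ∏ j ∈ Finset.range (β r), ∏ i ∈ Finset.range (α s - β s),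
    qNumber q (t r ^ q ^ (i + j)) (t s ^ q ^ (i + β r))

theorem weight_eq (hlam : Antitone lam) (q : ℕ) :
    weight α lam q =
      (∏ r, subsetWeight q (pivotComposition α lam r) (MvPolynomial.X r) (blockPivots α lam r)) *
        crossFactor q α (pivotComposition α lam) MvPolynomial.X := by
  rw [weight, crossFactor, ← Finset.prod_mul_distrib]
  refine Finset.prod_congr rfl fun r _ => ?_
  rw [← Finset.Ioi_insert, Finset.prod_insert (by simp), blockWeight_self hlam]
  congr 1
  exact Finset.prod_congr rfl fun s hs => blockWeight_of_lt hlam q (Finset.mem_Ioi.1 hs)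

theorem mem_partitionsOver {β : Fin l → ℕ} :
    lam ∈ partitionsOver α k β ↔
      lam ∈ boxPartitions (∑ r, α r) k ∧ pivotComposition α lam = β := by
  simp [partitionsOver]

theorem range_pivot_eq (hk : k ≤ ∑ r, α r) (hlam : lam ∈ boxPartitions (∑ r, α r) k) :
    Set.range (pivot lam) =
      {m | ∃ c : Σ s : Fin l, Fin (α s), (c.2 : ℕ) ∈ blockPivots α lam c.1 ∧ column α c = m} := by
  ext m
  constructor
  · rintro ⟨i, rfl⟩
    obtain ⟨c, hc⟩ := exists_column_eq α (pivot_lt hk hlam i)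
    exact ⟨c, mem_blockPivots.2 ⟨c.2.2, i, hc.symm⟩, hc⟩
  · rintro ⟨c, hc, rfl⟩
    obtain ⟨-, i, hi⟩ := mem_blockPivots.1 hc
    exact ⟨i, hi⟩

theorem exists_partition_of_blockPivots {β : Fin l → ℕ} (hβ : ∑ r, β r = k)
    {S : Fin l → Finset ℕ} (hS : ∀ r, S r ∈ (Finset.range (α r)).powersetCard (β r)) :
    ∃ lam ∈ partitionsOver α k β, blockPivots α lam = S := by
  classical
  simp only [Finset.mem_powersetCard] at hS
  set T : Finset ℕ := (Finset.univ.sigma S).image fun c => blockStart α c.1 + c.2 with hT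
  have hlt : ∀ r, ∀ x ∈ S r, x < α r := fun r x hx => Finset.mem_range.1 ((hS r).1 hx)
  have hcard : T.card = k := by
    rw [hT, Finset.card_image_of_injOn, Finset.card_sigma, ← hβ]
    · exact Finset.sum_congr rfl fun r _ => (hS r).2
    · rintro ⟨r, x⟩ hx ⟨s, y⟩ hy h
      simp only [Finset.coe_sigma, Set.mem_sigma_iff, Finset.mem_coe] at hx hy
      obtain ⟨rfl, rfl⟩ := block_unique α (hlt r x hx.2) (hlt s y hy.2) h
      rfl
  obtain ⟨lam, hlam, hr⟩ := exists_boxPartition (n := ∑ r, α r) T (fun m hm => by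
    obtain ⟨⟨r, x⟩, hx, rfl⟩ := Finset.mem_image.1 hm
    have := blockStart_add_le_sum α r
    have := hlt r x (Finset.mem_sigma.1 hx).2
    simp only [Finset.mem_range]
    omega) hcard
  have hbp : blockPivots α lam = S := by
    funext r
    ext x
    rw [mem_blockPivots]
    change _ ∧ blockStart α r + x ∈ Set.range (pivot lam) ↔ _
    rw [hr, Finset.mem_coe, hT, Finset.mem_image]
    constructor
    · rintro ⟨hx, ⟨s, y⟩, hy, h⟩
      have hy := (Finset.mem_sigma.1 hy).2
      obtain ⟨rfl, rfl⟩ := block_unique α (hlt s y hy) hx h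
      exact hy
    · exact fun hx => ⟨hlt r x hx, ⟨r, x⟩, Finset.mem_sigma.2 ⟨Finset.mem_univ _, hx⟩, rfl⟩
  refine ⟨lam, mem_partitionsOver.2 ⟨hlam, ?_⟩, hbp⟩
  funext r
  rw [← card_blockPivots (mem_boxPartitions.1 hlam).2, hbp, (hS r).2]

/-- The pivot sets of the blocks can be chosen independently; this is what turns the sum of weights
into a product. -/
theorem sum_partitionsOver {M : Type*} [AddCommMonoid M] (hk : k ≤ ∑ r, α r) {β : Fin l → ℕ}
    (hβ : ∑ r, β r = k) (f : (Fin l → Finset ℕ) → M) :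
    ∑ lam ∈ partitionsOver α k β, f (blockPivots α lam) =
      ∑ S ∈ Fintype.piFinset fun r => (Finset.range (α r)).powersetCard (β r), f S := by
  have h1 : ∀ lam ∈ partitionsOver α k β, Antitone lam ∧ ∀ r, pivotComposition α lam r = β r :=
    fun lam hlam => ⟨(mem_boxPartitions.1 (mem_partitionsOver.1 hlam).1).2,
      congrFun (mem_partitionsOver.1 hlam).2⟩
  refine Finset.sum_nbij (blockPivots α) ?_ ?_ ?_ fun _ _ => rfl
  · intro lam hlam
    refine Fintype.mem_piFinset.2 fun r => Finset.mem_powersetCard.2 ⟨blockPivots_subset r, ?_⟩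
    rw [card_blockPivots (h1 lam hlam).1, (h1 lam hlam).2]
  · intro lam hlam mu hmu h
    have hlam := (mem_partitionsOver.1 (Finset.mem_coe.1 hlam)).1
    have hmu := (mem_partitionsOver.1 (Finset.mem_coe.1 hmu)).1
    have e : Set.range (pivot lam) = Set.range (pivot mu) := by
      rw [range_pivot_eq hk hlam, range_pivot_eq hk hmu, h]
    exact pivot_injOn (mem_boxPartitions.1 hlam).2 (mem_boxPartitions.1 hmu).2 e
  · intro S hS
    exact exists_partition_of_blockPivots hβ (Fintype.mem_piFinset.1 (Finset.mem_coe.1 hS))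

theorem sievingPolynomial_eq (hk : k ≤ ∑ r, α r) {β : Fin l → ℕ} (hβ : ∑ r, β r = k) (q : ℕ) :
    sievingPolynomial α k q β =
      (∏ r, gaussSum q (α r) (β r) (MvPolynomial.X r)) * crossFactor q α β MvPolynomial.X := by
  have h : ∀ lam ∈ partitionsOver α k β, weight α lam q =
      (∏ r, subsetWeight q (β r) (MvPolynomial.X r) (blockPivots α lam r)) *
        crossFactor q α β MvPolynomial.X := by
    intro lam hlam
    obtain ⟨hlam, hb⟩ := mem_partitionsOver.1 hlam
    rw [weight_eq (mem_boxPartitions.1 hlam).2 q, hb]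
  have h2 := sum_partitionsOver hk hβ fun S =>
    ∏ r, subsetWeight q (β r) (MvPolynomial.X r : MvPolynomial (Fin l) ℤ) (S r)
  have h3 := Finset.prod_univ_sum (fun r => (Finset.range (α r)).powersetCard (β r))
    fun r S => subsetWeight q (β r) (MvPolynomial.X r : MvPolynomial (Fin l) ℤ) S
  rw [sievingPolynomial, Finset.sum_congr rfl h, ← Finset.sum_mul, h2, ← h3]
  rfl

theorem map_sievingPolynomial {R : Type*} [CommRing R] (hk : k ≤ ∑ r, α r) {β : Fin l → ℕ}
    (hβ : ∑ r, β r = k) (q : ℕ) (f : MvPolynomial (Fin l) ℤ →+* R) :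
    f (sievingPolynomial α k q β) =
      (∏ r, gaussSum q (α r) (β r) (f (MvPolynomial.X r))) *
        crossFactor q α β fun r => f (MvPolynomial.X r) := by
  simp [sievingPolynomial_eq hk hβ, crossFactor, map_gaussSum, map_qNumber]

theorem map_sievingPolynomial_one {q : ℕ} (hq : 1 < q) (hk : k ≤ ∑ r, α r) {β : Fin l → ℕ}
    (hβ : ∑ r, β r = k) :
    ((MvPolynomial.eval (fun _ => (1 : ℤ)) (sievingPolynomial α k q β) : ℤ) : ℚ) =
        (∏ r, qBinomial q (α r) (β r)) *
          ∏ r, ∏ s ∈ Finset.Ioi r, (q : ℚ) ^ (β r * (α s - β s)) := by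
  have h := map_sievingPolynomial hk hβ q
    ((Int.castRingHom ℚ).comp (MvPolynomial.eval fun _ => (1 : ℤ)))
  rw [RingHom.comp_apply, eq_intCast] at h
  rw [h, crossFactor]
  simp only [RingHom.comp_apply, MvPolynomial.eval_X, map_one, gaussSum_one hq, one_pow]
  congr 1
  refine Finset.prod_congr rfl fun r _ => Finset.prod_congr rfl fun s _ => ?_
  simp [qNumber, ← pow_mul, mul_comm]

theorem map_sievingPolynomial_fractionRing {q : ℕ} (hq : 1 < q) (hk : k ≤ ∑ r, α r)
    {β : Fin l → ℕ} (hβ : ∑ r, β r = k) (t : Fin l → FractionRing (MvPolynomial (Fin l) ℤ))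
    (ht : ∀ r, t r = algebraMap (MvPolynomial (Fin l) ℤ) _ (MvPolynomial.X r)) :
    algebraMap (MvPolynomial (Fin l) ℤ) (FractionRing (MvPolynomial (Fin l) ℤ))
        (sievingPolynomial α k q β) =
      (∏ r, ∏ i ∈ Finset.range (β r),
        (t r ^ q ^ α r - t r ^ q ^ i) / (t r ^ q ^ β r - t r ^ q ^ i)) * crossFactor q α β t := by
  rw [map_sievingPolynomial hk hβ, funext ht]
  congr 1
  refine Finset.prod_congr rfl fun r _ => ?_
  rw [Finset.prod_div_distrib, eq_div_iff, gaussSum_mul_prod]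
  refine Finset.prod_ne_zero_iff.2 fun i hi h => ?_
  rw [Finset.mem_range] at hi
  rw [sub_eq_zero, ← map_pow, ← map_pow] at h
  have h' := FaithfulSMul.algebraMap_injective _ _ h
  -- The denominators are nonzero because the two powers of the variable have different degrees.
  have h2 := congrArg MvPolynomial.totalDegree h'
  rw [MvPolynomial.totalDegree_X_pow, MvPolynomial.totalDegree_X_pow] at h2
  exact hi.ne' (Nat.pow_right_injective hq h2)

end PivotSets

/-! ### Counting submodules of direct sums by homomorphisms. -/

section Exactness

variable {A : Type*} [CommRing A]

theorem card_hom_of_exact {P N N' N'' : Type*} [AddCommGroup P] [AddCommGroup N]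
    [AddCommGroup N'] [AddCommGroup N''] [Module A P] [Module A N] [Module A N'] [Module A N'']
    [Module.Projective A P] (i : N' →ₗ[A] N) (p : N →ₗ[A] N'') (hi : Function.Injective i)
    (hp : Function.Surjective p) (hip : Function.Exact i p) :
    Nat.card (P →ₗ[A] N) = Nat.card (P →ₗ[A] N') * Nat.card (P →ₗ[A] N'') := by
  let f : (P →ₗ[A] N) →ₗ[A] (P →ₗ[A] N'') := LinearMap.llcomp A P N N'' p
  have hf : Function.Surjective f := fun g => by
    obtain ⟨h, hh⟩ := Module.projective_lifting_property p g hp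
    exact ⟨h, hh⟩
  let g : (P →ₗ[A] N') →ₗ[A] (P →ₗ[A] N) := LinearMap.llcomp A P N' N i
  have hg : Function.Injective g := fun x y h => LinearMap.ext fun a =>
    hi (LinearMap.congr_fun h a)
  have hr : LinearMap.range g = LinearMap.ker f := by
    ext h
    constructor
    · rintro ⟨x, rfl⟩
      exact LinearMap.ext fun a => hip.apply_apply_eq_zero _
    · intro h0
      have h1 : ∀ a, h a ∈ LinearMap.range i := fun a => (hip _).1 (LinearMap.congr_fun h0 a)
      refine ⟨(LinearEquiv.ofInjective i hi).symm.toLinearMap ∘ₗ h.codRestrict _ h1, ?_⟩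
      refine LinearMap.ext fun a => ?_
      have := LinearEquiv.apply_symm_apply (LinearEquiv.ofInjective i hi)
        (h.codRestrict (LinearMap.range i) h1 a)
      exact congrArg Subtype.val this
  have h1 := AddSubgroup.card_eq_card_quotient_mul_card_addSubgroup
    (LinearMap.ker f).toAddSubgroup
  have h2 : Nat.card ((P →ₗ[A] N) ⧸ (LinearMap.ker f).toAddSubgroup) =
      Nat.card (P →ₗ[A] N'') := Nat.card_congr (f.quotKerEquivOfSurjective hf).toEquiv
  have h3 : Nat.card (LinearMap.ker f).toAddSubgroup = Nat.card (P →ₗ[A] N') := by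
    change Nat.card (LinearMap.ker f) = _
    rw [← hr]
    exact (Nat.card_congr (LinearEquiv.ofInjective g hg).toEquiv).symm
  rw [h1, h2, h3, mul_comm]

/-- `Hom(P, -)` is applied to the exact sequence `0 → N / (Z ∩ N) → (M × N) / Z → M / pr Z → 0`. -/
theorem card_hom_prod_quotient {P M N : Type*} [AddCommGroup P] [AddCommGroup M]
    [AddCommGroup N] [Module A P] [Module A M] [Module A N] [Module.Projective A P]
    (Z : Submodule A (M × N)) :
    Nat.card (P →ₗ[A] ((M × N) ⧸ Z)) =
      Nat.card (P →ₗ[A] (M ⧸ Z.map (LinearMap.fst A M N))) *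
        Nat.card (P →ₗ[A] (N ⧸ Z.comap (LinearMap.inr A M N))) := by
  rw [mul_comm]
  let i : (N ⧸ Z.comap (LinearMap.inr A M N)) →ₗ[A] ((M × N) ⧸ Z) :=
    Submodule.mapQ _ _ (LinearMap.inr A M N) le_rfl
  let p : ((M × N) ⧸ Z) →ₗ[A] (M ⧸ Z.map (LinearMap.fst A M N)) :=
    Submodule.mapQ _ _ (LinearMap.fst A M N) (Submodule.le_comap_map _ _)
  refine card_hom_of_exact i p ?_ ?_ ?_
  · rw [injective_iff_map_eq_zero]
    intro x
    obtain ⟨x, rfl⟩ := Submodule.mkQ_surjective _ x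
    intro h
    simp only [Submodule.mkQ_apply, i, Submodule.mapQ_apply, Submodule.Quotient.mk_eq_zero] at h ⊢
    exact h
  · intro x
    obtain ⟨x, rfl⟩ := Submodule.mkQ_surjective _ x
    exact ⟨Submodule.Quotient.mk (x, 0), rfl⟩
  · intro x
    obtain ⟨⟨m, n⟩, rfl⟩ := Submodule.mkQ_surjective _ x
    simp only [Submodule.mkQ_apply, p, Submodule.mapQ_apply, Submodule.Quotient.mk_eq_zero]
    constructor
    · rintro ⟨⟨m', n'⟩, hz, h⟩
      refine ⟨Submodule.Quotient.mk (n - n'), ?_⟩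
      simp only [i, Submodule.mapQ_apply]
      rw [Submodule.Quotient.eq]
      have h : m' = m := h
      have : LinearMap.inr A M N (n - n') - (m, n) = -(m', n') := by
        simp [h]
      rw [this]
      exact Z.neg_mem hz
    · rintro ⟨y, hy⟩
      obtain ⟨y, rfl⟩ := Submodule.mkQ_surjective _ y
      simp only [i, Submodule.mkQ_apply, Submodule.mapQ_apply] at hy
      rw [Submodule.Quotient.eq] at hy
      refine ⟨_, Z.neg_mem hy, ?_⟩
      simp

/-- The submodule of `M × N` that is glued from `Y ≤ M` and `Z ≤ N` by a map `Y → N / Z`. -/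
def glue {M N : Type*} [AddCommGroup M] [AddCommGroup N] [Module A M] [Module A N]
    (Y : Submodule A M) (Z : Submodule A N) (f : Y →ₗ[A] (N ⧸ Z)) : Submodule A (M × N) where
  carrier := {x | ∃ h : x.1 ∈ Y, f ⟨x.1, h⟩ = Submodule.Quotient.mk x.2}
  zero_mem' := ⟨Y.zero_mem, f.map_zero⟩
  add_mem' := by
    rintro x y ⟨hx, hx'⟩ ⟨hy, hy'⟩
    refine ⟨Y.add_mem hx hy, ?_⟩
    have := f.map_add ⟨_, hx⟩ ⟨_, hy⟩
    rw [hx', hy'] at this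
    exact this
  smul_mem' := by
    rintro a x ⟨hx, hx'⟩
    refine ⟨Y.smul_mem a hx, ?_⟩
    have := f.map_smul a ⟨_, hx⟩
    rw [hx'] at this
    exact this

/-- A Goursat argument: modulo `Z`, such a `W` is the graph of a map `Y → N / Z`, and `glue` is the
inverse construction. -/
theorem card_submodule_prod {M N : Type*} [AddCommGroup M] [AddCommGroup N] [Module A M]
    [Module A N] (Y : Submodule A M) (Z : Submodule A N) :
    Nat.card {W : Submodule A (M × N) //
        W.map (LinearMap.fst A M N) = Y ∧ W.comap (LinearMap.inr A M N) = Z} =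
      Nat.card (Y →ₗ[A] (N ⧸ Z)) := by
  symm
  refine Nat.card_congr (Equiv.ofBijective (fun f => ⟨glue Y Z f, ?_, ?_⟩) ⟨?_, ?_⟩)
  · ext y
    constructor
    · rintro ⟨x, ⟨hx, -⟩, rfl⟩
      exact hx
    · intro hy
      obtain ⟨n, hn⟩ := Submodule.mkQ_surjective _ (f ⟨y, hy⟩)
      exact ⟨(y, n), ⟨hy, hn.symm⟩, rfl⟩
  · ext z
    constructor
    · rintro ⟨h, hz⟩
      have h0 : f ⟨0, h⟩ = 0 := f.map_zero
      exact (Submodule.Quotient.mk_eq_zero Z).1 (hz.symm.trans h0)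
    · intro hz
      exact ⟨Y.zero_mem, f.map_zero.trans ((Submodule.Quotient.mk_eq_zero Z).2 hz).symm⟩
  · intro f g h
    have h : glue Y Z f = glue Y Z g := congrArg Subtype.val h
    refine LinearMap.ext fun y => ?_
    obtain ⟨n, hn⟩ := Submodule.mkQ_surjective _ (f y)
    have hmem : (y.1, n) ∈ glue Y Z f := ⟨y.2, hn.symm⟩
    rw [h] at hmem
    obtain ⟨_, h'⟩ := hmem
    exact hn.symm.trans h'.symm
  · rintro ⟨W, rfl, rfl⟩
    have hex : ∀ y : W.map (LinearMap.fst A M N), ∃ n, (y.1, n) ∈ W := by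
      rintro ⟨_, ⟨m, n⟩, hw, rfl⟩
      exact ⟨n, hw⟩
    choose s hs using hex
    -- Two lifts of `y` to `W` differ by an element of `W ∩ N`, so the class of the chosen lift is
    -- canonical, and linearity follows.
    have key : ∀ (y : W.map (LinearMap.fst A M N)) (n : N), (y.1, n) ∈ W →
        (Submodule.Quotient.mk (s y) : N ⧸ W.comap (LinearMap.inr A M N)) =
          Submodule.Quotient.mk n := by
      intro y n hn
      rw [Submodule.Quotient.eq]
      have := W.sub_mem (hs y) hn
      simpa using this
    refine ⟨{ toFun := fun y => Submodule.Quotient.mk (s y)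
              map_add' := fun y y' => key _ _ (by simpa using W.add_mem (hs y) (hs y'))
              map_smul' := fun a y => key _ _ (by simpa using W.smul_mem a (hs y)) }, ?_⟩
    apply Subtype.ext
    ext ⟨m, n⟩
    constructor
    · rintro ⟨h, h'⟩
      have h' : Submodule.Quotient.mk (s ⟨m, h⟩) = Submodule.Quotient.mk n := h'
      rw [Submodule.Quotient.eq] at h'
      have h2 : ((0 : M), s ⟨m, h⟩ - n) ∈ W := h'
      have := W.sub_mem (hs ⟨m, h⟩) h2
      simpa using this
    · intro h
      exact ⟨⟨_, h, rfl⟩, key _ _ h⟩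

end Exactness

section Graded

variable {A : Type*} [CommRing A]

/-- The graded pieces of a submodule `Z` of `⨁_r M_r` with respect to the filtration by the
submodules `⨁_{s ≥ r} M_s`. -/
def graded {l : ℕ} {M : Fin l → Type*} [∀ r, AddCommGroup (M r)] [∀ r, Module A (M r)]
    (Z : Submodule A (∀ r, M r)) (r : Fin l) : Submodule A (M r) where
  carrier := {x | ∃ z ∈ Z, (∀ s < r, z s = 0) ∧ z r = x}
  zero_mem' := ⟨0, Z.zero_mem, fun _ _ => rfl, rfl⟩
  add_mem' := by
    rintro _ _ ⟨z, hz, h, rfl⟩ ⟨z', hz', h', rfl⟩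
    exact ⟨z + z', Z.add_mem hz hz', fun s hs => by simp [h s hs, h' s hs], rfl⟩
  smul_mem' := by
    rintro a _ ⟨z, hz, h, rfl⟩
    exact ⟨a • z, Z.smul_mem a hz, fun s hs => by simp [h s hs], rfl⟩

variable {l : ℕ} {M : Fin (l + 1) → Type*} [∀ r, AddCommGroup (M r)] [∀ r, Module A (M r)]

theorem graded_zero (Z : Submodule A (∀ r, M r)) :
    graded Z 0 = (Z.comap (Fin.consLinearEquiv A M).toLinearMap).map (LinearMap.fst A _ _) := by
  ext x
  constructor
  · rintro ⟨z, hz, -, rfl⟩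
    refine ⟨(z 0, fun i => z i.succ), ?_, rfl⟩
    change Fin.cons (z 0) (fun i => z i.succ) ∈ Z
    rw [show Fin.cons (z 0) (fun i => z i.succ) = z from Fin.cons_self_tail z]
    exact hz
  · rintro ⟨z, hz, rfl⟩
    exact ⟨_, hz, fun s hs => (Fin.not_lt_zero s hs).elim, rfl⟩

theorem graded_succ (Z : Submodule A (∀ r, M r)) (i : Fin l) :
    graded Z i.succ =
      graded ((Z.comap (Fin.consLinearEquiv A M).toLinearMap).comap (LinearMap.inr A _ _)) i := by
  ext x
  constructor
  · rintro ⟨z, hz, h, rfl⟩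
    refine ⟨fun i => z i.succ, ?_, fun s hs => h _ (Fin.succ_lt_succ_iff.2 hs), rfl⟩
    change Fin.cons 0 (fun i => z i.succ) ∈ Z
    rw [← h 0 (Fin.succ_pos i), show Fin.cons (z 0) (fun i => z i.succ) = z from
      Fin.cons_self_tail z]
    exact hz
  · rintro ⟨z, hz, h, rfl⟩
    refine ⟨_, hz, fun s hs => ?_, rfl⟩
    cases s using Fin.cases with
    | zero => rfl
    | succ s => exact h s (Fin.succ_lt_succ_iff.1 hs)

end Graded

section GradedCount

variable {A : Type*} [CommRing A]

theorem card_hom_quotient {P : Type*} [AddCommGroup P] [Module A P] [Module.Projective A P]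
    {l : ℕ} {M : Fin l → Type*} [∀ r, AddCommGroup (M r)] [∀ r, Module A (M r)]
    (Z : Submodule A (∀ r, M r)) :
    Nat.card (P →ₗ[A] ((∀ r, M r) ⧸ Z)) = ∏ r, Nat.card (P →ₗ[A] (M r ⧸ graded Z r)) := by
  induction l with
  | zero =>
    have : Subsingleton ((∀ r, M r) ⧸ Z) := (Submodule.mkQ_surjective Z).subsingleton
    simp
  | succ l ih =>
    have e : ((∀ r, M r) ⧸ Z) ≃ₗ[A]
        ((M 0 × ∀ i : Fin l, M i.succ) ⧸ Z.comap (Fin.consLinearEquiv A M).toLinearMap) :=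
      (Submodule.Quotient.equiv _ _ (Fin.consLinearEquiv A M)
        (Submodule.map_comap_eq_of_surjective (Fin.consLinearEquiv A M).surjective Z)).symm
    rw [Nat.card_congr (LinearEquiv.congrRight e).toEquiv, card_hom_prod_quotient, ih,
      Fin.prod_univ_succ, graded_zero]
    congr 1
    exact Finset.prod_congr rfl fun i _ => by rw [graded_succ]

/-- Induction on the number of summands: a submodule amounts to its intersection `Z` with the last
`l` summands together with a map from `Y 0` to their quotient by `Z`. -/
theorem card_submodule_graded [IsSemisimpleRing A]
    {l : ℕ} {M : Fin l → Type*} [∀ r, AddCommGroup (M r)] [∀ r, Module A (M r)]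
    [∀ r, Finite (M r)] (Y : ∀ r, Submodule A (M r)) :
    Nat.card {Z : Submodule A (∀ r, M r) // ∀ r, graded Z r = Y r} =
      ∏ r, ∏ s ∈ Finset.Ioi r, Nat.card (Y r →ₗ[A] (M s ⧸ Y s)) := by
  induction l with
  | zero =>
    have : Unique {Z : Submodule A (∀ r, M r) // ∀ r, graded Z r = Y r} :=
      { default := ⟨⊤, fun r => r.elim0⟩
        uniq := fun Z => Subtype.ext (Subsingleton.elim _ _) }
    simp
  | succ l ih =>
    let B := {Z : Submodule A (∀ i : Fin l, M i.succ) // ∀ i, graded Z i = Y i.succ}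
    let e : {Z : Submodule A (∀ r, M r) // ∀ r, graded Z r = Y r} ≃
        Σ Z : B, {W : Submodule A (M 0 × ∀ i : Fin l, M i.succ) //
          W.map (LinearMap.fst A _ _) = Y 0 ∧ W.comap (LinearMap.inr A _ _) = Z.1} :=
      { toFun := fun Z => ⟨⟨(Z.1.comap (Fin.consLinearEquiv A M).toLinearMap).comap
            (LinearMap.inr A _ _), fun i => by rw [← graded_succ, Z.2]⟩,
          ⟨Z.1.comap (Fin.consLinearEquiv A M).toLinearMap, by rw [← graded_zero, Z.2], rfl⟩⟩
        invFun := fun p => ⟨p.2.1.map (Fin.consLinearEquiv A M).toLinearMap, fun r => by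
          cases r using Fin.cases with
          | zero => rw [graded_zero, Submodule.comap_map_eq_of_injective
              (Fin.consLinearEquiv A M).injective, p.2.2.1]
          | succ r => rw [graded_succ, Submodule.comap_map_eq_of_injective
              (Fin.consLinearEquiv A M).injective, p.2.2.2, p.1.2]⟩
        left_inv := fun Z => Subtype.ext
          (Submodule.map_comap_eq_of_surjective (Fin.consLinearEquiv A M).surjective Z.1)
        right_inv := by
          rintro ⟨⟨Z, hZ⟩, ⟨W, hW, hW'⟩⟩
          have := Submodule.comap_map_eq_of_injective (Fin.consLinearEquiv A M).injective W
          refine Sigma.subtype_ext (Subtype.ext ?_) this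
          exact (congrArg (Submodule.comap (LinearMap.inr A _ _)) this).trans hW' }
    have : Finite B := inferInstance
    have := Fintype.ofFinite B
    rw [Nat.card_congr e, Nat.card_sigma]
    -- Semisimplicity makes `Y 0` projective, so this number depends only on the graded pieces of
    -- `Z` and the sum over `Z` is constant.
    have hc : ∀ Z : B, Nat.card {W : Submodule A (M 0 × ∀ i : Fin l, M i.succ) //
        W.map (LinearMap.fst A _ _) = Y 0 ∧ W.comap (LinearMap.inr A _ _) = Z.1} =
        ∏ i : Fin l, Nat.card (Y 0 →ₗ[A] (M i.succ ⧸ Y i.succ)) := by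
      intro Z
      have : Module.Projective A (Y 0) := Module.projective_of_isSemisimpleRing A (Y 0)
      rw [card_submodule_prod, card_hom_quotient]
      exact Finset.prod_congr rfl fun i _ => by rw [Z.2 i]
    rw [Finset.sum_congr rfl fun Z _ => hc Z, Finset.sum_const, Finset.card_univ,
      ← Nat.card_eq_fintype_card, ih fun i => Y i.succ, smul_eq_mul, Fin.prod_univ_succ,
      Fin.prod_Ioi_zero, mul_comm]
    congr 1
    exact Finset.prod_congr rfl fun i _ => by
      rw [Fin.prod_Ioi_succ (fun s => Nat.card (Y i.succ →ₗ[A] (M s ⧸ Y s)))]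

end GradedCount

/-! ### Counting over finite fields and residue fields. -/

section Subspaces

/-- Linearly independent `b`-tuples are counted twice: in `E`, and subspace by subspace according to
their span. -/
theorem card_subspaces (K E : Type*) [Field K] [AddCommGroup E] [Module K E] [Finite K]
    [Finite E] (b : ℕ) :
    (Nat.card {Y : Submodule K E // Module.finrank K Y = b} : ℚ) =
      qBinomial (Nat.card K) (Module.finrank K E) b := by
  have := Fintype.ofFinite K
  have := Fintype.ofFinite E
  have hq : 1 < Nat.card K := Finite.one_lt_card
  by_cases hb : b ≤ Module.finrank K E
  · let X := {Y : Submodule K E // Module.finrank K Y = b}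
    let f : (Σ Y : X, {s : Fin b → Y.1 // LinearIndependent K s}) →
        {s : Fin b → E // LinearIndependent K s} := fun p => ⟨fun i => p.2.1 i,
      p.2.2.map' (Submodule.subtype _) (Submodule.ker_subtype _)⟩
    have hspan : ∀ p, Submodule.span K (Set.range (f p).1) = p.1.1 := fun p => by
      apply Submodule.eq_of_le_of_finrank_eq
      · rw [Submodule.span_le]
        rintro _ ⟨i, rfl⟩
        exact (p.2.1 i).2
      · rw [finrank_span_eq_card (f p).2, Fintype.card_fin, p.1.2]
    have hf : Function.Bijective f := by
      constructor
      · intro p p' h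
        have hY : p.1 = p'.1 := Subtype.ext (by rw [← hspan, ← hspan, h])
        obtain ⟨Y, s⟩ := p
        obtain ⟨Y', s'⟩ := p'
        obtain rfl : Y = Y' := hY
        congr 1
        refine Subtype.ext (funext fun i => Subtype.ext ?_)
        exact congrFun (congrArg Subtype.val h) i
      · intro s
        exact ⟨⟨⟨Submodule.span K (Set.range s.1), by
            rw [finrank_span_eq_card s.2, Fintype.card_fin]⟩,
          ⟨fun i => ⟨s.1 i, Submodule.subset_span ⟨i, rfl⟩⟩,
            LinearIndependent.of_comp (Submodule.subtype _) s.2⟩⟩, rfl⟩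
    have : Fintype X := Fintype.ofFinite X
    have h1 := (Nat.card_congr (Equiv.ofBijective f hf)).symm
    rw [Nat.card_sigma, card_linearIndependent hb] at h1
    have h2 : ∀ Y : X, Nat.card {s : Fin b → Y.1 // LinearIndependent K s} =
        ∏ i : Fin b, (Fintype.card K ^ b - Fintype.card K ^ i.val) := fun Y => by
      rw [card_linearIndependent Y.2.ge, Y.2]
    rw [Finset.sum_congr rfl fun Y _ => h2 Y, Finset.sum_const, Finset.card_univ,
      ← Nat.card_eq_fintype_card, ← Nat.card_eq_fintype_card, smul_eq_mul] at h1
    have h3 : ∀ m, b ≤ m → ((∏ i : Fin b, (Nat.card K ^ m - Nat.card K ^ i.val) : ℕ) : ℚ) =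
        ∏ i ∈ Finset.range b, ((Nat.card K : ℚ) ^ m - (Nat.card K : ℚ) ^ i) := by
      intro m hm
      rw [← Fin.prod_univ_eq_prod_range (fun i => (Nat.card K : ℚ) ^ m - (Nat.card K : ℚ) ^ i) b]
      push_cast
      refine Finset.prod_congr rfl fun i _ => ?_
      rw [Nat.cast_sub (Nat.pow_le_pow_right hq.le (i.2.le.trans hm))]
      push_cast
      rfl
    have h4 := congrArg (Nat.cast : ℕ → ℚ) h1
    rw [Nat.cast_mul, h3 _ hb, h3 _ le_rfl] at h4
    rw [qBinomial, Finset.prod_div_distrib, eq_div_iff, h4]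
    refine Finset.prod_ne_zero_iff.2 fun i hi h => ?_
    rw [Finset.mem_range] at hi
    rw [sub_eq_zero] at h
    exact hi.ne' (Nat.pow_right_injective hq (by exact_mod_cast h))
  -- When `b` exceeds the dimension, the factor of the `q`-binomial at `i = finrank K E` is zero.
  · have : IsEmpty {Y : Submodule K E // Module.finrank K Y = b} :=
      ⟨fun Y => hb (Y.2 ▸ Submodule.finrank_le Y.1)⟩
    rw [Nat.card_of_isEmpty, Nat.cast_zero, qBinomial, Finset.prod_eq_zero
      (Finset.mem_range.2 (not_le.1 hb))]
    rw [sub_self, zero_div]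

end Subspaces

section Torsion

variable {A : Type*} [CommRing A] (I : Ideal A) [hI : I.IsMaximal]

/-- Modules killed by `I` are vector spaces over `A ⧸ I`, with the same linear maps, and `Y` has
dimension `b`. -/
theorem card_hom_of_isTorsionBySet [Finite (A ⧸ I)] {Y Q : Type*} [AddCommGroup Y] [Module A Y] [AddCommGroup Q]
    [Module A Q] [Finite Y] [Finite Q] (hY : Module.IsTorsionBySet A Y I)
    (hQ : Module.IsTorsionBySet A Q I) {b : ℕ} (hb : Nat.card Y = Nat.card (A ⧸ I) ^ b) :
    Nat.card (Y →ₗ[A] Q) = Nat.card Q ^ b := by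
  let := Ideal.Quotient.field I
  let := hY.module
  let := hQ.module
  have hs : Function.Surjective (algebraMap A (A ⧸ I)) := Ideal.Quotient.mk_surjective
  have h1 : Module.finrank (A ⧸ I) Y = b := by
    rw [Module.natCard_eq_pow_finrank (K := A ⧸ I)] at hb
    exact Nat.pow_right_injective Finite.one_lt_card hb
  let B := Module.finBasisOfFinrankEq (A ⧸ I) Y h1
  rw [Nat.card_congr (LinearMap.extendScalarsOfSurjectiveEquiv hs).toEquiv,
    ← Nat.card_congr (B.constr ℕ (M' := Q)).toEquiv, Nat.card_fun, Nat.card_fin]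

theorem exists_card_eq_pow {Y : Type*} [AddCommGroup Y] [Module A Y] [Finite Y]
    (hY : Module.IsTorsionBySet A Y I) : ∃ b, Nat.card Y = Nat.card (A ⧸ I) ^ b := by
  let := Ideal.Quotient.field I
  let := hY.module
  exact ⟨_, Module.natCard_eq_pow_finrank (K := A ⧸ I)⟩

theorem card_submodule_of_isTorsionBySet [Finite (A ⧸ I)] {E : Type*} [AddCommGroup E] [Module A E] [Finite E]
    (hE : Module.IsTorsionBySet A E I) {m : ℕ} (hm : Nat.card E = Nat.card (A ⧸ I) ^ m) (b : ℕ) :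
    (Nat.card {Y : Submodule A E // Nat.card Y = Nat.card (A ⧸ I) ^ b} : ℚ) =
      qBinomial (Nat.card (A ⧸ I)) m b := by
  let := Ideal.Quotient.field I
  let := hE.module
  have hs : Function.Surjective (algebraMap A (A ⧸ I)) := Ideal.Quotient.mk_surjective
  have h1 : Module.finrank (A ⧸ I) E = m := by
    rw [Module.natCard_eq_pow_finrank (K := A ⧸ I)] at hm
    exact Nat.pow_right_injective Finite.one_lt_card hm
  rw [← h1, ← card_subspaces]
  congr 1
  symm
  refine Nat.card_congr (Equiv.ofBijective (fun Y => ⟨Y.1.restrictScalars A, ?_⟩) ⟨?_, ?_⟩)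
  · have := Module.natCard_eq_pow_finrank (K := A ⧸ I) (V := Y.1)
    rw [Y.2] at this
    exact this
  · intro Y Y' h
    exact Subtype.ext (Submodule.restrictScalars_injective A (A ⧸ I) E (congrArg Subtype.val h))
  · rintro ⟨Y, hY⟩
    let Y' : Submodule (A ⧸ I) E :=
      { carrier := Y
        zero_mem' := Y.zero_mem
        add_mem' := Y.add_mem
        smul_mem' := fun c x hx => by
          obtain ⟨a, rfl⟩ := hs c
          rw [algebraMap_smul]
          exact Y.smul_mem a hx }
    refine ⟨⟨Y', ?_⟩, Subtype.ext (Submodule.ext fun _ => Iff.rfl)⟩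
    have h2 : Nat.card Y' = _ := Module.natCard_eq_pow_finrank (K := A ⧸ I) (V := Y')
    exact Nat.pow_right_injective (Finite.one_lt_card (α := A ⧸ I)) (h2.symm.trans hY)

end Torsion

/-! ### The action of `A` on each field, and conjugacy of the images of its generator. -/

section Kernels

variable {F A E : Type*} [CommRing A] [Field E] [Algebra A E]

variable (A E) in
theorem ker_isMaximal [Finite A] : (RingHom.ker (algebraMap A E)).IsMaximal := by
  have := RingHom.ker_isPrime (algebraMap A E)
  exact IsArtinianRing.isMaximal_of_isPrime _

variable (F A E) in
/-- The degree over `F` of the image of `A` in `E`. -/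
def imageDegree [Field F] [Algebra F A] : ℕ :=
  Module.finrank F (A ⧸ RingHom.ker (algebraMap A E))

theorem card_quotient_ker [Field F] [Algebra F A] [Finite A] :
    Nat.card (A ⧸ RingHom.ker (algebraMap A E)) = Nat.card F ^ imageDegree F A E :=
  Module.natCard_eq_pow_finrank

variable (F A E) in
theorem imageDegree_pos [Field F] [Algebra F A] [Finite A] : 0 < imageDegree F A E := by
  have := ker_isMaximal A E
  have : Nontrivial (A ⧸ RingHom.ker (algebraMap A E)) :=
    Ideal.Quotient.nontrivial_iff.2 this.ne_top
  exact Module.finrank_pos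

variable (A E) in
theorem isTorsionBySet_ker : Module.IsTorsionBySet A E (RingHom.ker (algebraMap A E)) := by
  rintro x ⟨a, ha⟩
  change a • x = 0
  rw [Algebra.smul_def, RingHom.mem_ker.1 ha, zero_mul]

theorem isTorsionBySet_submodule {M : Type*} [AddCommGroup M] [Module A M] {I : Ideal A}
    (h : Module.IsTorsionBySet A M I) (Y : Submodule A M) : Module.IsTorsionBySet A Y I :=
  fun x a => Subtype.ext (@h x a)

/-- Write `1 = a + b` with `a` killing the source and `b` the target; every map is then zero. -/
theorem card_hom_of_ne {M N : Type*} [AddCommGroup M] [Module A M] [AddCommGroup N] [Module A N]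
    {I J : Ideal A} [I.IsMaximal] [J.IsMaximal] (hIJ : I ≠ J) (hM : Module.IsTorsionBySet A M I)
    (hN : Module.IsTorsionBySet A N J) : Nat.card (M →ₗ[A] N) = 1 := by
  obtain ⟨a, ha, b, hb, hab⟩ := Ideal.isCoprime_iff_exists.1 (Ideal.isCoprime_of_isMaximal hIJ)
  have h0 : ∀ f : M →ₗ[A] N, f = 0 := fun f => by
    ext x
    rw [← one_smul A x, ← hab, add_smul, map_add, map_smul f b]
    rw [show a • x = 0 from @hM x ⟨a, ha⟩, show b • f x = 0 from @hN (f x) ⟨b, hb⟩]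
    simp
  rw [Nat.card_eq_one_iff_unique]
  exact ⟨⟨fun f g => (h0 f).trans (h0 g).symm⟩, ⟨0⟩⟩

variable (E) in
theorem imageDegree_dvd_of_card_eq [Field F] [Finite F] [Algebra F A] [Finite A] {M : Type*}
    [AddCommGroup M] [Module A M] [Finite M]
    (hM : Module.IsTorsionBySet A M (RingHom.ker (algebraMap A E))) {b : ℕ}
    (h : Nat.card M = Nat.card F ^ b) : imageDegree F A E ∣ b := by
  have := ker_isMaximal A E
  obtain ⟨c, hc⟩ := exists_card_eq_pow _ hM
  rw [h, card_quotient_ker (F := F), ← pow_mul] at hc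
  exact ⟨c, Nat.pow_right_injective Finite.one_lt_card hc⟩

end Kernels

section Frobenius

variable {F : Type*} [Field F] [Finite F]

theorem exists_frobenius_pow (R : Type*) [CommRing R] [Algebra F R] (c : ℕ) :
    ∃ f : R →ₐ[F] R, ∀ x, f x = x ^ Nat.card F ^ c := by
  have := Fintype.ofFinite F
  refine ⟨FiniteField.frobeniusAlgHom F R ^ c, fun x => ?_⟩
  rw [AlgHom.coe_pow, FiniteField.coe_frobeniusAlgHom, pow_iterate, Nat.card_eq_fintype_card]

theorem pow_card_pow_injective {E : Type*} [Field E] [Algebra F E] (c : ℕ) :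
    Function.Injective fun x : E => x ^ Nat.card F ^ c := by
  obtain ⟨f, hf⟩ := exists_frobenius_pow (F := F) E c
  intro x y h
  exact f.toRingHom.injective (by simpa [hf] using h)

theorem hasFrobeniusPeriod_of_forall {E : Type*} [Field E] [Algebra F E] {u : E} {d : ℕ}
    (h : ∀ c, u ^ Nat.card F ^ c = u ↔ d ∣ c) : HasFrobeniusPeriod (Nat.card F) u d := by
  have key : ∀ i c, u ^ Nat.card F ^ i = u ^ Nat.card F ^ (i + c) ↔ i ≡ i + c [MOD d] := by
    intro i c
    have e : i ≡ i + c [MOD d] ↔ d ∣ c := by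
      rw [← Nat.modEq_zero_iff_dvd]
      constructor
      · intro h
        exact (Nat.ModEq.add_left_cancel' i (by simpa using h)).symm
      · intro h
        simpa using (Nat.ModEq.add_left i h).symm
    rw [e, ← h, add_comm, pow_add, pow_mul]
    exact ⟨fun h => (pow_card_pow_injective (F := F) i h).symm, fun h => by rw [h]⟩
  intro i j
  rcases le_total i j with hij | hij
  · obtain ⟨c, rfl⟩ := Nat.exists_eq_add_of_le hij
    exact key i c
  · obtain ⟨c, rfl⟩ := Nat.exists_eq_add_of_le hij
    rw [eq_comm, key j c]
    exact ⟨Nat.ModEq.symm, Nat.ModEq.symm⟩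

theorem HasFrobeniusPeriod.map_units {E K : Type*} [Field E] [Field K] {q d : ℕ} {u : Eˣ}
    (h : HasFrobeniusPeriod q (u : E) d) (w : Eˣ →* Kˣ) (hw : Function.Injective w) :
    HasFrobeniusPeriod q (w u : K) d := by
  intro i j
  rw [← h i j, ← Units.val_pow_eq_pow_val, ← Units.val_pow_eq_pow_val, ← Units.val_pow_eq_pow_val,
    ← Units.val_pow_eq_pow_val, Units.val_inj, Units.val_inj, ← map_pow, ← map_pow, hw.eq_iff]

variable {A : Type*} [CommRing A] [Algebra F A] [Finite A] {g : A}

/-- Since `g` generates `A`, a Frobenius power fixing `g` modulo `I` is trivial on `A ⧸ I`, where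
the order of Frobenius is the degree. -/
theorem pow_card_pow_eq_iff_dvd (hg : Algebra.adjoin F {g} = ⊤) (I : Ideal A) [I.IsMaximal]
    (c : ℕ) : g ^ Nat.card F ^ c - g ∈ I ↔ Module.finrank F (A ⧸ I) ∣ c := by
  let := Ideal.Quotient.field I
  have := Fintype.ofFinite F
  have : Finite (A ⧸ I) := Finite.of_surjective _ Ideal.Quotient.mk_surjective
  let φ := FiniteField.frobeniusAlgHom F (A ⧸ I)
  have hφ : ∀ x, (φ ^ c) x = x ^ Nat.card F ^ c := fun x => by
    rw [AlgHom.coe_pow, FiniteField.coe_frobeniusAlgHom, pow_iterate, Nat.card_eq_fintype_card]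
  rw [← FiniteField.orderOf_frobeniusAlgHom F (A ⧸ I), orderOf_dvd_iff_pow_eq_one]
  constructor
  · intro h
    have h2 : (φ ^ c).comp (Ideal.Quotient.mkₐ F I) = Ideal.Quotient.mkₐ F I := by
      apply AlgHom.ext_of_adjoin_eq_top hg
      rintro _ rfl
      rw [AlgHom.comp_apply, hφ, ← map_pow]
      exact Ideal.Quotient.eq.2 h
    ext x
    obtain ⟨a, rfl⟩ := Ideal.Quotient.mk_surjective x
    exact AlgHom.congr_fun h2 a
  · intro h
    rw [← Ideal.Quotient.eq, map_pow, ← hφ]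
    exact AlgHom.congr_fun h _

variable {E : Type*} [Field E] [Algebra F E] [Algebra A E]

theorem hasFrobeniusPeriod_algebraMap (hg : Algebra.adjoin F {g} = ⊤) :
    HasFrobeniusPeriod (Nat.card F) (algebraMap A E g) (imageDegree F A E) := by
  have := ker_isMaximal A E
  apply hasFrobeniusPeriod_of_forall (F := F)
  intro c
  rw [imageDegree, ← pow_card_pow_eq_iff_dvd hg, RingHom.mem_ker, map_sub, map_pow, sub_eq_zero]

variable [IsScalarTower F A E] {E' : Type*} [Field E'] [Algebra F E'] [Algebra A E'] [IsScalarTower F A E']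
  {Ω : Type*} [Field Ω] [Algebra F Ω]

/-- Both maps to `Ω` factor through the field `A ⧸ I`. Composing one embedding with the Frobenius
powers already gives as many embeddings as the degree allows, so the other one is among them. -/
theorem exists_conjugate_of_ker_eq
    (h : RingHom.ker (algebraMap A E) = RingHom.ker (algebraMap A E'))
    (e : E →ₐ[F] Ω) (e' : E' →ₐ[F] Ω) :
    ∃ c, e' (algebraMap A E' g) = e (algebraMap A E g) ^ Nat.card F ^ c := by
  have := ker_isMaximal A E
  set I := RingHom.ker (algebraMap A E) with hI
  let := Ideal.Quotient.field I
  have := Fintype.ofFinite F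
  have : Finite (A ⧸ I) := Finite.of_surjective _ Ideal.Quotient.mk_surjective
  let i : (A ⧸ I) →ₐ[F] Ω := Ideal.Quotient.liftₐ I (e.comp (IsScalarTower.toAlgHom F A E))
    fun a ha => by simp [RingHom.mem_ker.1 (hI ▸ ha)]
  let i' : (A ⧸ I) →ₐ[F] Ω := Ideal.Quotient.liftₐ I (e'.comp (IsScalarTower.toAlgHom F A E'))
    fun a ha => by simp [RingHom.mem_ker.1 (h ▸ ha)]
  let φ := FiniteField.frobeniusAlgHom F (A ⧸ I)
  have hφ : ∀ c x, (φ ^ c) x = x ^ Nat.card F ^ c := fun c x => by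
    rw [AlgHom.coe_pow, FiniteField.coe_frobeniusAlgHom, pow_iterate, Nat.card_eq_fintype_card]
  have hinj : Function.Injective fun n : Fin (Module.finrank F (A ⧸ I)) =>
      i.comp (φ ^ n.1) := by
    intro m n hmn
    apply (FiniteField.bijective_frobeniusAlgHom_pow F (A ⧸ I)).1
    ext x
    exact i.toRingHom.injective (AlgHom.congr_fun hmn x)
  have hb := hinj.bijective_of_nat_card_le (by
    rw [Nat.card_fin]; exact card_algHom_le_finrank F (A ⧸ I) Ω)
  obtain ⟨c, hc⟩ := hb.2 i'
  refine ⟨c, ?_⟩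
  have h1 := AlgHom.congr_fun hc (Ideal.Quotient.mk I g)
  rw [AlgHom.comp_apply, hφ, map_pow] at h1
  exact h1.symm

end Frobenius

section Conjugate

variable {F A E E' Ω : Type*} [Field F] [Finite F] [CommRing A] [Algebra F A] {g : A} [Field E]
  [Algebra F E] [Algebra A E] [IsScalarTower F A E] [Field E'] [Algebra F E'] [Algebra A E']
  [IsScalarTower F A E'] [Field Ω] [Algebra F Ω]

theorem ker_eq_of_conjugate (hg : Algebra.adjoin F {g} = ⊤) (e : E →ₐ[F] Ω) (e' : E' →ₐ[F] Ω)
    {c : ℕ} (h : e' (algebraMap A E' g) = e (algebraMap A E g) ^ Nat.card F ^ c) :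
    RingHom.ker (algebraMap A E) = RingHom.ker (algebraMap A E') := by
  obtain ⟨f, hf⟩ := exists_frobenius_pow (F := F) Ω c
  have h2 : (e'.comp (IsScalarTower.toAlgHom F A E')) =
      f.comp (e.comp (IsScalarTower.toAlgHom F A E)) := by
    apply AlgHom.ext_of_adjoin_eq_top hg
    rintro _ rfl
    simp [hf, h]
  ext a
  have h3 := AlgHom.congr_fun h2 a
  simp only [AlgHom.comp_apply, IsScalarTower.toAlgHom_apply] at h3
  rw [RingHom.mem_ker, RingHom.mem_ker, ← map_eq_zero_iff e' e'.toRingHom.injective, h3,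
    map_eq_zero_iff f f.toRingHom.injective, map_eq_zero_iff e e.toRingHom.injective]

end Conjugate

/-! ### Compatible embeddings into the complex numbers. -/

section Compatible

variable {F : Type*} [Field F] {l : ℕ} {E : Fin l → Type*} [∀ r, Field (E r)]
  [∀ r, Algebra F (E r)] [∀ r, Finite (E r)] {ι : ∀ r, E r →ₐ[F] AlgebraicClosure F}
  {ω : ∀ r, (E r)ˣ →* ℂˣ}

/-- The converse of `agree`. Equal images force equal orders, so `ι s v` is a root of unity
generated by `ι r u`, say `ι r (u ^ i)`; then `agree` and injectivity give `u ^ i = u`. -/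
theorem IsCompatible.eq_of_eq (h : IsCompatible ι ω) {r s : Fin l} {u : (E r)ˣ} {v : (E s)ˣ}
    (huv : ω s v = ω r u) : ι s v = ι r u := by
  have ho : orderOf v = orderOf u := by
    rw [← orderOf_injective (ω s) (h.injective s), huv, orderOf_injective (ω r) (h.injective r)]
  have hp : IsPrimitiveRoot (ι r u) (orderOf u) := by
    have := IsPrimitiveRoot.coe_units_iff.2 (IsPrimitiveRoot.orderOf u)
    exact this.map_of_injective (ι r).toRingHom.injective
  have : NeZero (orderOf u) := ⟨(orderOf_pos u).ne'⟩
  obtain ⟨i, -, hi⟩ := hp.eq_pow_of_pow_eq_one (ξ := ι s v) (by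
    rw [← map_pow, ← Units.val_pow_eq_pow_val, ← ho, pow_orderOf_eq_one, Units.val_one, map_one])
  have h1 : ι r ((u ^ i : (E r)ˣ) : E r) = ι s v := by
    rw [Units.val_pow_eq_pow_val, map_pow, hi]
  have h2 := h.agree r s (u ^ i) v h1
  rw [huv] at h2
  rw [← h1, h.injective r h2]

variable (ι) in
-- The compositum of the images is a finite field; an embedding of its cyclic unit group into `ℂˣ`
-- restricts to all `E r` at once.
theorem exists_isCompatible [Finite F] : ∃ ω : ∀ r, (E r)ˣ →* ℂˣ, IsCompatible ι ω := by
  let L : IntermediateField F (AlgebraicClosure F) := ⨆ r, (ι r).fieldRange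
  have hfin : ∀ r, FiniteDimensional F (ι r).fieldRange := fun r =>
    Module.Finite.equiv (AlgEquiv.ofInjectiveField (ι r)).toLinearEquiv
  have : FiniteDimensional F L := IntermediateField.finiteDimensional_iSup_of_finite
  have : Finite L := Module.finite_of_finite F
  have hle : ∀ r x, ι r x ∈ L := fun r x =>
    (le_iSup (fun r => (ι r).fieldRange) r : _ ≤ L) ⟨x, rfl⟩
  let j : ∀ r, E r →ₐ[F] L := fun r => (ι r).codRestrict L.toSubalgebra (hle r)
  have : NeZero (Nat.card Lˣ) := ⟨Nat.card_pos.ne'⟩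
  let e : Lˣ ≃* rootsOfUnity (Nat.card Lˣ) ℂ :=
    mulEquivOfCyclicCardEq (Complex.card_rootsOfUnity _).symm
  let w : Lˣ →* ℂˣ := (rootsOfUnity (Nat.card Lˣ) ℂ).subtype.comp e.toMonoidHom
  have hw : Function.Injective w := Subtype.val_injective.comp e.injective
  refine ⟨fun r => w.comp (Units.map (j r : E r →* L)), fun r => ?_, fun r s u v h => ?_⟩
  · exact hw.comp (Units.map_injective (j r).toRingHom.injective)
  · refine congrArg w (Units.ext (Subtype.ext h))

end Compatible

/-! ### Matching submodule counts with the evaluated polynomial. -/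

section FixedPoints

variable {F : Type*} [Field F] [Finite F] {l : ℕ} {E : Fin l → Type*} [∀ r, Field (E r)]
  [∀ r, Algebra F (E r)] [∀ r, Finite (E r)] {ι : ∀ r, E r →ₐ[F] AlgebraicClosure F}
  {ω : ∀ r, (E r)ˣ →* ℂˣ}
  {A : Type*} [CommRing A] [Algebra F A] [Finite A] {g : A} [∀ r, Algebra A (E r)]
  {u : ∀ r, (E r)ˣ} {α β : Fin l → ℕ}

theorem card_submodule_eq_gaussSum (hω : IsCompatible ι ω) (hg : Algebra.adjoin F {g} = ⊤)
    (hu : ∀ r, algebraMap A (E r) g = u r) (hα : ∀ r, Nat.card (E r) = Nat.card F ^ α r)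
    (r : Fin l) (b : ℕ) :
    (Nat.card {Y : Submodule A (E r) // Nat.card Y = Nat.card F ^ b} : ℂ) =
      gaussSum (Nat.card F) (α r) b (ω r (u r) : ℂ) := by
  have hper : HasFrobeniusPeriod (Nat.card F) (ω r (u r) : ℂ) (imageDegree F A (E r)) := by
    have := hasFrobeniusPeriod_algebraMap (F := F) (E := E r) hg
    rw [hu] at this
    exact this.map_units (ω r) (hω.injective r)
  have hq : 1 < Nat.card F := Finite.one_lt_card
  have hm := ker_isMaximal A (E r)
  have hd := imageDegree_pos F A (E r)
  have hda := imageDegree_dvd_of_card_eq (E r) (isTorsionBySet_ker A (E r)) (hα r)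
  by_cases hb : imageDegree F A (E r) ∣ b
  · obtain ⟨b, rfl⟩ := hb
    obtain ⟨a, ha⟩ := hda
    have hcard := hα r
    rw [ha] at hcard ⊢
    have : Finite (A ⧸ RingHom.ker (algebraMap A (E r))) := Finite.of_surjective _ Ideal.Quotient.mk_surjective
    rw [gaussSum_mul_mul hq (Units.ne_zero _) hd hper]
    rw [pow_mul, ← card_quotient_ker] at hcard
    rw [pow_mul, ← card_quotient_ker (A := A) (E := E r),
      ← card_submodule_of_isTorsionBySet _ (isTorsionBySet_ker A (E r)) hcard, Rat.cast_natCast]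
  · have : IsEmpty {Y : Submodule A (E r) // Nat.card Y = Nat.card F ^ b} :=
      ⟨fun Y => hb (imageDegree_dvd_of_card_eq (E r)
        (isTorsionBySet_submodule (isTorsionBySet_ker A (E r)) Y.1) Y.2)⟩
    rw [gaussSum_eq_zero_of_not_dvd hq (Units.ne_zero _) hd hper hda hb, Nat.card_of_isEmpty,
      Nat.cast_zero]

variable [∀ r, IsScalarTower F A (E r)]

/-- The kernels of `A` on `E r` and `E s` coincide exactly when `u r` and `u s` are conjugate over
`F`, so the two cases for Hom match the two evaluations of the product. -/
theorem card_hom_eq_prod (hω : IsCompatible ι ω) (hg : Algebra.adjoin F {g} = ⊤)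
    (hu : ∀ r, algebraMap A (E r) g = u r) (hα : ∀ r, Nat.card (E r) = Nat.card F ^ α r)
    (hβ : ∀ r, β r ≤ α r) (r s : Fin l) (Y : Submodule A (E r)) (Z : Submodule A (E s))
    (hY : Nat.card Y = Nat.card F ^ β r) (hZ : Nat.card Z = Nat.card F ^ β s) :
    (Nat.card (Y →ₗ[A] (E s ⧸ Z)) : ℂ) =
      ∏ j ∈ Finset.range (β r), ∏ i ∈ Finset.range (α s - β s),
        qNumber (Nat.card F) ((ω r (u r) : ℂ) ^ Nat.card F ^ (i + j))
          ((ω s (u s) : ℂ) ^ Nat.card F ^ (i + β r)) := by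
  have hper : ∀ r, HasFrobeniusPeriod (Nat.card F) (ω r (u r) : ℂ) (imageDegree F A (E r)) :=
    fun r => by
      have := hasFrobeniusPeriod_algebraMap (F := F) (E := E r) hg
      rw [hu] at this
      exact this.map_units (ω r) (hω.injective r)
  have hmr := ker_isMaximal A (E r)
  have hms := ker_isMaximal A (E s)
  have hYt := isTorsionBySet_submodule (isTorsionBySet_ker A (E r)) Y
  have hQt := (isTorsionBySet_ker A (E s)).quotient Z
  have hdr := imageDegree_dvd_of_card_eq (E r) hYt hY
  have hds : imageDegree F A (E s) ∣ α s - β s :=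
    Nat.dvd_sub (imageDegree_dvd_of_card_eq (E s) (isTorsionBySet_ker A (E s)) (hα s))
      (imageDegree_dvd_of_card_eq (E s) (isTorsionBySet_submodule (isTorsionBySet_ker A (E s)) Z) hZ)
  have hQ : Nat.card (E s ⧸ Z) = Nat.card F ^ (α s - β s) := by
    have h1 := Submodule.card_eq_card_quotient_mul_card Z
    rw [hα, hZ, ← Nat.add_sub_cancel' (hβ s), pow_add] at h1
    exact (Nat.eq_of_mul_eq_mul_left (Nat.pow_pos Nat.card_pos) h1).symm
  by_cases hI : RingHom.ker (algebraMap A (E r)) = RingHom.ker (algebraMap A (E s))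
  · obtain ⟨c, hc⟩ := exists_conjugate_of_ker_eq (g := g) hI (ι r) (ι s)
    rw [hu, hu, ← map_pow, ← Units.val_pow_eq_pow_val] at hc
    have hw := congrArg (Units.val) (hω.agree _ _ _ _ hc)
    rw [map_pow, Units.val_pow_eq_pow_val] at hw
    have hd : imageDegree F A (E s) = imageDegree F A (E r) := by
      rw [imageDegree, ← hI]
      rfl
    obtain ⟨b, hb⟩ := hdr
    have : Finite (A ⧸ RingHom.ker (algebraMap A (E r))) := Finite.of_surjective _ Ideal.Quotient.mk_surjective
    rw [← hI] at hQt
    have : Finite (E s ⧸ Z) := Finite.of_surjective _ Z.mkQ_surjective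
    rw [card_hom_of_isTorsionBySet _ hYt hQt (b := b) (by
      rw [hY, card_quotient_ker (F := F), ← pow_mul, hb]), hb,
      prod_prod_qNumber_of_conjugate (imageDegree_pos F A (E r)) (Units.ne_zero _) (hper r) hw
        (hd ▸ hds), hQ]
    push_cast
    rfl
  · rw [card_hom_of_ne hI hYt hQt, prod_prod_qNumber_of_not_conjugate (imageDegree_pos F A (E s))
      (hper r) (hper s) _ hdr hds, Nat.cast_one]
    intro c hc
    rw [← Units.val_pow_eq_pow_val, Units.val_inj, ← map_pow] at hc
    have h1 := hω.eq_of_eq hc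
    rw [Units.val_pow_eq_pow_val, map_pow, ← hu, ← hu] at h1
    exact hI (ker_eq_of_conjugate hg (ι r) (ι s) h1)

theorem card_submodule_graded_eq [IsSemisimpleRing A] (hω : IsCompatible ι ω)
    (hg : Algebra.adjoin F {g} = ⊤) (hu : ∀ r, algebraMap A (E r) g = u r)
    (hα : ∀ r, Nat.card (E r) = Nat.card F ^ α r) (hβ : ∀ r, β r ≤ α r) :
    (Nat.card {Z : Submodule A (∀ r, E r) // ∀ r, Nat.card (graded Z r) = Nat.card F ^ β r} : ℂ) =
      (∏ r, gaussSum (Nat.card F) (α r) (β r) (ω r (u r) : ℂ)) *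
        crossFactor (Nat.card F) α β fun r => (ω r (u r) : ℂ) := by
  classical
  let B := ∀ r, {Y : Submodule A (E r) // Nat.card Y = Nat.card F ^ β r}
  let e : {Z : Submodule A (∀ r, E r) // ∀ r, Nat.card (graded Z r) = Nat.card F ^ β r} ≃
      Σ Y : B, {Z : Submodule A (∀ r, E r) // ∀ r, graded Z r = (Y r).1} :=
    { toFun := fun Z => ⟨fun r => ⟨graded Z.1 r, Z.2 r⟩, ⟨Z.1, fun _ => rfl⟩⟩
      invFun := fun p => ⟨p.2.1, fun r => by rw [p.2.2 r]; exact (p.1 r).2⟩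
      left_inv := fun _ => rfl
      right_inv := fun p =>
        Sigma.subtype_ext (funext fun r => Subtype.ext (p.2.2 r)) rfl }
  have : Fintype B := Fintype.ofFinite B
  rw [Nat.card_congr e, Nat.card_sigma, Nat.cast_sum]
  have h1 : ∀ Y : B, (Nat.card {Z : Submodule A (∀ r, E r) // ∀ r, graded Z r = (Y r).1} : ℂ) =
      crossFactor (Nat.card F) α β fun r => (ω r (u r) : ℂ) := by
    intro Y
    rw [card_submodule_graded fun r => (Y r).1, crossFactor]
    push_cast
    refine Finset.prod_congr rfl fun r _ => Finset.prod_congr rfl fun s _ => ?_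
    exact card_hom_eq_prod hω hg hu hα hβ r s _ _ (Y r).2 (Y s).2
  rw [Finset.sum_congr rfl fun Y _ => h1 Y, Finset.sum_const, nsmul_eq_mul, Finset.card_univ,
    ← Nat.card_eq_fintype_card, Nat.card_pi]
  push_cast
  congr 1
  exact Finset.prod_congr rfl fun r _ => card_submodule_eq_gaussSum hω hg hu hα r (β r)

end FixedPoints

/-! ### Last nonzero coordinates and reduced bases. -/

section LeadSet

theorem exists_last_ne_zero {F C : Type*} [Zero F] [Finite C] {ρ : C → ℕ} {z : C → F} (hz : z ≠ 0) :
    ∃ c, z c ≠ 0 ∧ ∀ c', ρ c < ρ c' → z c' = 0 := by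
  obtain ⟨c0, hc0⟩ := Function.ne_iff.1 hz
  obtain ⟨c, hc, hmax⟩ := Set.exists_max_image {c | z c ≠ 0} ρ (Set.toFinite _) ⟨c0, hc0⟩
  exact ⟨c, hc, fun c' h => by_contra fun h' => (hmax c' h').not_gt h⟩

variable {F C : Type*} [Field F] [Fintype C] (ρ : C → ℕ)

open Classical in
/-- The positions of the last nonzero coordinates of the vectors in `Z`, for the ordering of the
coordinates by `ρ`. -/
def leadSet (Z : Submodule F (C → F)) : Finset C :=
  Finset.univ.filter fun c => ∃ z ∈ Z, z c ≠ 0 ∧ ∀ c', ρ c < ρ c' → z c' = 0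

variable {ρ} {Z : Submodule F (C → F)}

theorem mem_leadSet {c : C} :
    c ∈ leadSet ρ Z ↔ ∃ z ∈ Z, z c ≠ 0 ∧ ∀ c', ρ c < ρ c' → z c' = 0 := by
  simp [leadSet]

variable (ρ Z) in
/-- The restriction of the vectors of `Z` to the coordinates in `leadSet ρ Z`. -/
def leadRestrict : Z →ₗ[F] (leadSet ρ Z → F) :=
  LinearMap.funLeft F F Subtype.val ∘ₗ Z.subtype

theorem leadRestrict_apply (z : Z) (c : leadSet ρ Z) : leadRestrict ρ Z z c = z.1 c := rfl

theorem leadRestrict_injective : Function.Injective (leadRestrict ρ Z) := by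
  rw [injective_iff_map_eq_zero]
  intro z hz
  by_contra hne
  obtain ⟨c, hc, hc'⟩ := exists_last_ne_zero (ρ := ρ) (z := z.1) fun h => hne (Subtype.ext h)
  exact hc (congrFun hz ⟨c, mem_leadSet.2 ⟨z, z.2, hc, hc'⟩⟩)

/-- Triangularity: a vector that ends at `c` restricts to a nonzero multiple of the unit vector at
`c` plus unit vectors at earlier positions, which are reached by induction. -/
theorem leadRestrict_surjective (hρ : Function.Injective ρ) :
    Function.Surjective (leadRestrict ρ Z) := by
  classical
  have key : ∀ n, ∀ c : leadSet ρ Z, ρ c < n →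
      Pi.single c 1 ∈ LinearMap.range (leadRestrict ρ Z) := by
    intro n
    induction n with
    | zero => exact fun c h => (Nat.not_lt_zero _ h).elim
    | succ n ih =>
      intro c hn
      obtain ⟨z, hz, hzc, hz'⟩ := mem_leadSet.1 c.2
      have h1 := pi_eq_sum_univ' (leadRestrict ρ Z ⟨z, hz⟩)
      rw [← Finset.add_sum_erase _ _ (Finset.mem_univ c)] at h1
      have h2 : ∑ c' ∈ Finset.univ.erase c, leadRestrict ρ Z ⟨z, hz⟩ c' •
          (Pi.single c' 1 : leadSet ρ Z → F) ∈ LinearMap.range (leadRestrict ρ Z) := by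
        refine Submodule.sum_mem _ fun c' hc' => ?_
        rcases lt_trichotomy (ρ c') (ρ c) with h | h | h
        · exact Submodule.smul_mem _ _ (ih c' (by omega))
        · exact ((Finset.mem_erase.1 hc').1 (Subtype.ext (hρ h))).elim
        · change z c' • (Pi.single c' 1 : leadSet ρ Z → F) ∈ _
          rw [hz' _ h, zero_smul]
          exact Submodule.zero_mem _
      have h3 : leadRestrict ρ Z ⟨z, hz⟩ c • (Pi.single c 1 : leadSet ρ Z → F) ∈
          LinearMap.range (leadRestrict ρ Z) := by
        rw [← Submodule.add_mem_iff_left _ h2]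
        exact h1 ▸ ⟨_, rfl⟩
      exact (Submodule.smul_mem_iff _ hzc).1 h3
  intro v
  change v ∈ LinearMap.range (leadRestrict ρ Z)
  rw [pi_eq_sum_univ' v]
  exact Submodule.sum_mem _ fun c _ => Submodule.smul_mem _ _ (key _ c (Nat.lt_succ_self _))

theorem finrank_eq_card_leadSet (hρ : Function.Injective ρ) :
    Module.finrank F Z = (leadSet ρ Z).card := by
  rw [(LinearEquiv.ofBijective (leadRestrict ρ Z)
    ⟨leadRestrict_injective, leadRestrict_surjective hρ⟩).finrank_eq, Module.finrank_pi,
    Fintype.card_coe]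

theorem exists_reduced_vector (hρ : Function.Injective ρ) {c : C} (hc : c ∈ leadSet ρ Z) :
    ∃ z ∈ Z, z c = 1 ∧ (∀ c', ρ c < ρ c' → z c' = 0) ∧
      ∀ c' ∈ leadSet ρ Z, c' ≠ c → z c' = 0 := by
  classical
  obtain ⟨z, hz⟩ := leadRestrict_surjective hρ (Pi.single (⟨c, hc⟩ : leadSet ρ Z) (1 : F))
  have h1 : z.1 c = 1 := by
    rw [← leadRestrict_apply z ⟨c, hc⟩, hz, Pi.single_eq_same]
  have h2 : ∀ c' ∈ leadSet ρ Z, c' ≠ c → z.1 c' = 0 := fun c' hc' hne => by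
    rw [← leadRestrict_apply z ⟨c', hc'⟩, hz, Pi.single_eq_of_ne]
    exact fun h => hne (congrArg Subtype.val h)
  refine ⟨z, z.2, h1, ?_, h2⟩
  obtain ⟨d, hd, hd'⟩ := exists_last_ne_zero (ρ := ρ) (z := z.1) fun h => by simp [h] at h1
  have hdc : d = c := by
    by_contra hne
    exact hd (h2 d (mem_leadSet.2 ⟨z, z.2, hd, hd'⟩) hne)
  rwa [← hdc]

end LeadSet

/-! ### Schubert cells through pivot columns and graded pieces. -/

section Cells

variable {F : Type*} [Field F] {l : ℕ} {α : Fin l → ℕ} {k : ℕ} {lam : Fin k → ℕ}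

theorem leadSet_span_of_isEchelon
    {M : Matrix (Fin k) (Σ s : Fin l, Fin (α s)) F} (hM : IsEchelon lam M)
    (hcol : ∀ i, ∃ c, column α c = pivot lam i) (c : Σ s : Fin l, Fin (α s)) :
    c ∈ leadSet (column α) (Submodule.span F (Set.range M)) ↔
      column α c ∈ Set.range (pivot lam) := by
  constructor
  · intro hc
    obtain ⟨z, hz, hzc, hz'⟩ := mem_leadSet.1 hc
    obtain ⟨a, rfl⟩ := (Submodule.mem_span_range_iff_exists_fun F).1 hz
    -- The coefficients of a combination of rows can be read off at the pivot columns.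
    have hpiv : ∀ i c', column α c' = pivot lam i → (∑ i, a i • M i) c' = a i := by
      intro i c' h
      rw [Finset.sum_apply, Finset.sum_eq_single i]
      · simp [(hM i c').1 h]
      · intro j _ hji
        simp [(hM j c').2.2 i hji.symm h]
      · simp
    have ha : ∀ i, column α c < pivot lam i → a i = 0 := by
      intro i hi
      obtain ⟨c', hc'⟩ := hcol i
      rw [← hpiv i c' hc', hz' c' (by omega)]
    by_contra hne
    apply hzc
    rw [Finset.sum_apply]
    refine Finset.sum_eq_zero fun i _ => ?_
    rcases lt_trichotomy (column α c) (pivot lam i) with h | h | h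
    · simp [ha i h]
    · exact (hne ⟨i, h.symm⟩).elim
    · simp [(hM i c).2.1 h]
  · rintro ⟨i, hi⟩
    refine mem_leadSet.2 ⟨M i, Submodule.subset_span ⟨i, rfl⟩, ?_, fun c' h => ?_⟩
    · rw [(hM i c).1 hi.symm]
      exact one_ne_zero
    · exact (hM i c').2.1 (hi.trans_lt h)

theorem exists_isEchelon (hlam : Antitone lam) {Z : Submodule F ((Σ s : Fin l, Fin (α s)) → F)}
    (hcol : ∀ i, ∃ c, column α c = pivot lam i)
    (hZ : ∀ c, c ∈ leadSet (column α) Z ↔ column α c ∈ Set.range (pivot lam)) :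
    ∃ M : Matrix (Fin k) (Σ s : Fin l, Fin (α s)) F, IsEchelon lam M ∧
      Z = Submodule.span F (Set.range M) := by
  choose c hc using hcol
  have hcZ : ∀ i, c i ∈ leadSet (column α) Z := fun i => (hZ _).2 ⟨i, (hc i).symm⟩
  choose M hM1 hM2 hM3 hM4 using fun i => exists_reduced_vector (column_injective α) (hcZ i)
  have hceq : ∀ i c', column α c' = pivot lam i → c' = c i := fun i c' h =>
    column_injective α (h.trans (hc i).symm)
  have hcinj : ∀ i j, c i = c j → i = j := fun i j h =>
    (pivot_strictAnti hlam).injective (by rw [← hc, ← hc, h])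
  refine ⟨M, fun i c' => ⟨fun h => ?_, fun h => hM3 i c' (by rwa [hc]), fun j hj h => ?_⟩, ?_⟩
  · rw [hceq i c' h, hM2]
  · rw [hceq j c' h]
    exact hM4 i _ (hcZ j) fun h => hj (hcinj _ _ h)
  · apply le_antisymm
    · intro z hz
      have h : z = ∑ i, z (c i) • M i := by
        have hs : ∑ i, z (c i) • M i ∈ Z :=
          Submodule.sum_mem _ fun i _ => Submodule.smul_mem _ _ (hM1 i)
        have : (⟨z, hz⟩ : Z) = ⟨_, hs⟩ := by
          apply leadRestrict_injective (ρ := column α)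
          funext d
          rw [leadRestrict_apply, leadRestrict_apply]
          obtain ⟨i, hi⟩ := (hZ d).1 d.2
          change z d = (∑ j, z (c j) • M j) d
          rw [hceq i d.1 hi.symm, Finset.sum_apply, Finset.sum_eq_single i]
          · simp [hM2]
          · intro j _ hji
            simp [hM4 j (c i) (hcZ i) fun h => hji (hcinj _ _ h).symm]
          · simp
        exact congrArg Subtype.val this
      rw [h]
      exact Submodule.sum_mem _ fun i _ => Submodule.smul_mem _ _ (Submodule.subset_span ⟨i, rfl⟩)
    · rw [Submodule.span_le]
      rintro _ ⟨i, rfl⟩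
      exact hM1 i

variable {E : Fin l → Type*} [∀ r, Field (E r)] [∀ r, Algebra F (E r)]
  {b : ∀ r, Module.Basis (Fin (α r)) F (E r)}

/-- The positions of the last nonzero coordinates of the vectors in `Z`. -/
def pivotColumns (b : ∀ r, Module.Basis (Fin (α r)) F (E r)) (Z : Submodule F (∀ r, E r)) :
    Finset (Σ s : Fin l, Fin (α s)) :=
  leadSet (column α) (Z.map (Pi.basis b).equivFun.toLinearMap)

theorem mem_schubertCell (hk : k ≤ ∑ r, α r) (hlam : lam ∈ boxPartitions (∑ r, α r) k)
    {Z : Submodule F (∀ r, E r)} : Z ∈ schubertCell b lam ↔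
      ∀ c, c ∈ pivotColumns b Z ↔ column α c ∈ Set.range (pivot lam) := by
  have hanti := (mem_boxPartitions.1 hlam).2
  have hcol : ∀ i, ∃ c, column α c = pivot lam i := fun i =>
    exists_column_eq α (pivot_lt hk hlam i)
  have hspan : ∀ M : Matrix (Fin k) (Σ s : Fin l, Fin (α s)) F,
      Submodule.span F (Set.range fun i => (Pi.basis b).equivFun.symm (M i)) =
        (Submodule.span F (Set.range M)).map (Pi.basis b).equivFun.symm.toLinearMap := fun M => by
    rw [Submodule.map_span]
    exact congrArg (Submodule.span F) (Set.range_comp (Pi.basis b).equivFun.symm M)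
  constructor
  · rintro ⟨M, hM, rfl⟩
    have h : (Submodule.span F (Set.range fun i => (Pi.basis b).equivFun.symm (M i))).map
        (Pi.basis b).equivFun.toLinearMap = Submodule.span F (Set.range M) := by
      rw [hspan, ← Submodule.map_comp]
      simp
    intro c
    rw [pivotColumns, h]
    exact leadSet_span_of_isEchelon hM hcol c
  · intro h
    obtain ⟨M, hM, hMZ⟩ := exists_isEchelon hanti hcol h
    refine ⟨M, hM, ?_⟩
    rw [hspan, ← hMZ, ← Submodule.map_comp]
    simp

theorem basis_equivFun_apply (z : ∀ r, E r) (r : Fin l) (x : Fin (α r)) :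
    (Pi.basis b).equivFun z ⟨r, x⟩ = (b r).equivFun (z r) x := by
  simp [Pi.basis_repr]

/-- Blocks `s < r` lie to the right of block `r`. A vector whose last nonzero coordinate is in block
`r` thus vanishes on them, and its component in `E r` ends at the same place. -/
theorem mem_leadSet_graded (Z : Submodule F (∀ r, E r)) (r : Fin l) (x : Fin (α r)) :
    x ∈ leadSet (fun x : Fin (α r) => (x : ℕ)) ((graded Z r).map (b r).equivFun.toLinearMap) ↔
      (⟨r, x⟩ : Σ s : Fin l, Fin (α s)) ∈ pivotColumns b Z := by
  rw [pivotColumns, mem_leadSet, mem_leadSet]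
  constructor
  · rintro ⟨_, ⟨_, ⟨z, hz, hz0, rfl⟩, rfl⟩, hx, hx'⟩
    refine ⟨_, ⟨z, hz, rfl⟩, ?_, ?_⟩
    · exact fun h => hx ((basis_equivFun_apply z r x).symm.trans h)
    · rintro ⟨s, y⟩ hy
      change (Pi.basis b).equivFun z ⟨s, y⟩ = 0
      rw [basis_equivFun_apply]
      rcases lt_trichotomy s r with h | rfl | h
      · rw [hz0 s h, map_zero]
        rfl
      · exact hx' y (by simpa [column] using hy)
      · exact (hy.asymm (column_lt_column_of_lt α (c := ⟨s, y⟩) (c' := ⟨r, x⟩) h)).elim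
  · rintro ⟨_, ⟨z, hz, rfl⟩, hx, hx'⟩
    refine ⟨_, ⟨z r, ⟨z, hz, fun s hs => ?_, rfl⟩, rfl⟩, ?_, fun y hy => ?_⟩
    · apply (b s).equivFun.injective
      funext y
      rw [map_zero, ← basis_equivFun_apply]
      exact hx' ⟨s, y⟩ (column_lt_column_of_lt α (c := ⟨r, x⟩) (c' := ⟨s, y⟩) hs)
    · exact fun h => hx ((basis_equivFun_apply z r x).trans h)
    · exact (basis_equivFun_apply z r y).symm.trans (hx' ⟨r, y⟩ (Nat.add_lt_add_left hy _))

open Classical in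
theorem finrank_graded (b : ∀ r, Module.Basis (Fin (α r)) F (E r)) (Z : Submodule F (∀ r, E r))
    (r : Fin l) : Module.finrank F (graded Z r) =
      (Finset.univ.filter fun x : Fin (α r) =>
        (⟨r, x⟩ : Σ s : Fin l, Fin (α s)) ∈ pivotColumns b Z).card := by
  rw [← LinearEquiv.finrank_map_eq (b r).equivFun (graded Z r),
    finrank_eq_card_leadSet (ρ := fun x : Fin (α r) => (x : ℕ)) Fin.val_injective]
  congr 1
  ext x
  rw [Finset.mem_filter]
  simpa using mem_leadSet_graded Z r x

theorem sum_finrank_graded (b : ∀ r, Module.Basis (Fin (α r)) F (E r))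
    (Z : Submodule F (∀ r, E r)) : ∑ r, Module.finrank F (graded Z r) = Module.finrank F Z := by
  classical
  rw [Finset.sum_congr rfl fun r _ => finrank_graded b Z r, ← Finset.card_sigma,
    ← LinearEquiv.finrank_map_eq (Pi.basis b).equivFun Z,
    finrank_eq_card_leadSet (column_injective α)]
  congr 1
  ext c
  rw [Finset.mem_sigma, Finset.mem_filter]
  simp [pivotColumns]

theorem schubertUnion_eq {β : Fin l → ℕ} (hk : k ≤ ∑ r, α r) (hβ : ∑ r, β r = k) :
    schubertUnion k b β = {Z | ∀ r, Module.finrank F (graded Z r) = β r} := by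
  classical
  have himage : ∀ (Z : Submodule F (∀ r, E r)) r, ((Finset.univ.filter fun x : Fin (α r) =>
      (⟨r, x⟩ : Σ s : Fin l, Fin (α s)) ∈ pivotColumns b Z).map Fin.valEmbedding).card =
        Module.finrank F (graded Z r) := fun Z r => by
    rw [Finset.card_map, finrank_graded b]
  ext Z
  simp only [schubertUnion, Set.mem_iUnion, exists_prop]
  constructor
  · rintro ⟨lam, hlam, hZ⟩ r
    obtain ⟨hbox, rfl⟩ := mem_partitionsOver.1 hlam
    rw [mem_schubertCell hk hbox] at hZ
    rw [← card_blockPivots (mem_boxPartitions.1 hbox).2, ← himage]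
    congr 1
    ext x
    rw [mem_blockPivots]
    simp only [Finset.mem_map, Finset.mem_filter, Finset.mem_univ, true_and,
      Fin.valEmbedding_apply, hZ]
    constructor
    · rintro ⟨x, hx, rfl⟩
      exact ⟨x.2, hx⟩
    · rintro ⟨hx, h⟩
      exact ⟨⟨x, hx⟩, h, rfl⟩
  · intro hZ
    obtain ⟨lam, hlam, hS⟩ := exists_partition_of_blockPivots (α := α) hβ
      (S := fun r => (Finset.univ.filter fun x : Fin (α r) =>
        (⟨r, x⟩ : Σ s : Fin l, Fin (α s)) ∈ pivotColumns b Z).map Fin.valEmbedding) fun r => by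
      rw [Finset.mem_powersetCard, himage]
      refine ⟨fun x hx => ?_, hZ r⟩
      obtain ⟨x, -, rfl⟩ := Finset.mem_map.1 hx
      exact Finset.mem_range.2 x.2
    refine ⟨lam, hlam, ?_⟩
    have hbox := (mem_partitionsOver.1 hlam).1
    rw [mem_schubertCell hk hbox, range_pivot_eq hk hbox, hS]
    intro c
    constructor
    · intro hc
      exact ⟨c, Finset.mem_map.2 ⟨c.2, by simpa using hc, rfl⟩, rfl⟩
    · rintro ⟨c', hc', h⟩
      obtain rfl := column_injective α h
      obtain ⟨x, hx, hx'⟩ := Finset.mem_map.1 hc'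
      obtain rfl : x = c'.2 := Fin.ext hx'
      simpa using hx

end Cells

/-! ### Fixed subspaces as submodules. -/

section FixedSubspaces

variable {F : Type*} [Field F] {l : ℕ} {E : Fin l → Type*} [∀ r, Field (E r)]
  [∀ r, Algebra F (E r)]

theorem finrank_graded_smul (u : ∀ r, (E r)ˣ) (Z : Submodule F (∀ r, E r)) (r : Fin l) :
    Module.finrank F (graded (u • Z) r) = Module.finrank F (graded Z r) := by
  have h : graded (u • Z) r =
      (graded Z r).map (DistribMulAction.toLinearEquiv F (E r) (u r)).toLinearMap := by
    ext x
    constructor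
    · rintro ⟨_, ⟨z, hz, rfl⟩, h, rfl⟩
      refine ⟨z r, ⟨z, hz, fun s hs => ?_, rfl⟩, rfl⟩
      exact (smul_eq_zero_iff_eq (u s)).1 (h s hs)
    · rintro ⟨_, ⟨z, hz, h, rfl⟩, rfl⟩
      refine ⟨u • z, Submodule.smul_mem_pointwise_smul z u Z hz, fun s hs => ?_, rfl⟩
      exact (smul_eq_zero_iff_eq (u s)).2 (h s hs)
  rw [h, LinearEquiv.finrank_map_eq]

variable {A : Type*} [CommRing A] [Algebra F A] {g : A} [∀ r, Algebra A (E r)]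
  [∀ r, IsScalarTower F A (E r)] {u : ∀ r, (E r)ˣ} {β : Fin l → ℕ}

theorem smul_eq_units_smul (hu : ∀ r, algebraMap A (E r) g = u r) (z : ∀ r, E r) :
    g • z = u • z := by
  funext r
  change g • z r = (u r : E r) * z r
  rw [Algebra.smul_def, hu]

theorem smul_mem_of_smul_eq (hg : Algebra.adjoin F {g} = ⊤)
    (hu : ∀ r, algebraMap A (E r) g = u r) {Z : Submodule F (∀ r, E r)} (hZ : u • Z = Z) (a : A) :
    ∀ z ∈ Z, a • z ∈ Z := by
  have ha : a ∈ Algebra.adjoin F {g} := hg ▸ Algebra.mem_top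
  induction ha using Algebra.adjoin_induction with
  | mem x hx =>
    intro z hz
    rw [Set.mem_singleton_iff.1 hx, smul_eq_units_smul hu, ← hZ]
    exact Submodule.smul_mem_pointwise_smul z u Z hz
  | algebraMap c =>
    intro z hz
    rw [algebraMap_smul]
    exact Z.smul_mem c hz
  | add x y _ _ hx hy =>
    intro z hz
    rw [add_smul]
    exact Z.add_mem (hx z hz) (hy z hz)
  | mul x y _ _ hx hy =>
    intro z hz
    rw [mul_smul]
    exact hx _ (hy z hz)

/-- Stability under `g` gives only an inclusion; finiteness makes it an equality. -/
theorem smul_restrictScalars_eq [∀ r, Finite (E r)] (hu : ∀ r, algebraMap A (E r) g = u r)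
    (Z : Submodule A (∀ r, E r)) : u • Z.restrictScalars F = Z.restrictScalars F := by
  apply SetLike.coe_injective
  refine Set.eq_of_subset_of_ncard_le ?_ ?_ (Set.toFinite _)
  · rintro _ ⟨z, hz, rfl⟩
    change u • z ∈ Z
    rw [← smul_eq_units_smul hu]
    exact Z.smul_mem g hz
  · rw [Submodule.coe_pointwise_smul, Set.ncard_smul_set]

theorem ncard_fixed [Finite F] [∀ r, Finite (E r)] (hg : Algebra.adjoin F {g} = ⊤)
    (hu : ∀ r, algebraMap A (E r) g = u r) :
    {Z : Submodule F (∀ r, E r) |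
        (∀ r, Module.finrank F (graded Z r) = β r) ∧ u • Z = Z}.ncard =
      Nat.card {Z : Submodule A (∀ r, E r) //
        ∀ r, Nat.card (graded Z r) = Nat.card F ^ β r} := by
  have hcard : ∀ (Z : Submodule A (∀ r, E r)) r, Nat.card (graded Z r) =
      Nat.card F ^ Module.finrank F (graded (Z.restrictScalars F) r) := fun Z r =>
    Module.natCard_eq_pow_finrank (K := F) (V := graded (Z.restrictScalars F) r)
  rw [← Nat.card_coe_set_eq]
  symm
  refine Nat.card_congr (Equiv.ofBijective
    (fun Z => ⟨Z.1.restrictScalars F, fun r => ?_, smul_restrictScalars_eq hu Z.1⟩) ⟨?_, ?_⟩)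
  · exact Nat.pow_right_injective Finite.one_lt_card ((hcard Z.1 r).symm.trans (Z.2 r))
  · intro Z Z' h
    exact Subtype.ext (Submodule.restrictScalars_injective F A _ (congrArg Subtype.val h))
  · rintro ⟨Z, hZ, hZu⟩
    let Z' : Submodule A (∀ r, E r) :=
      { carrier := Z
        zero_mem' := Z.zero_mem
        add_mem' := Z.add_mem
        smul_mem' := fun a z hz => smul_mem_of_smul_eq hg hu hZu a z hz }
    have hZ' : Z'.restrictScalars F = Z := Submodule.ext fun _ => Iff.rfl
    refine ⟨⟨Z', fun r => ?_⟩, Subtype.ext hZ'⟩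
    rw [hcard, hZ', hZ r]

end FixedSubspaces

/-! ### Assembly: cyclic sieving and the Vandermonde identity. -/

section Main

theorem card_eq_pow_of_basis {F : Type*} [Field F] {l : ℕ} {E : Fin l → Type*} [∀ r, Field (E r)]
    [∀ r, Algebra F (E r)] {α : Fin l → ℕ} (b : ∀ r, Module.Basis (Fin (α r)) F (E r))
    (r : Fin l) : Nat.card (E r) = Nat.card F ^ α r := by
  have := (b r).finiteDimensional_of_finite
  rw [Module.natCard_eq_pow_finrank (K := F), Module.finrank_eq_card_basis (b r), Fintype.card_fin]

variable {F : Type*} [Field F] [Finite F] {l : ℕ} {E : Fin l → Type*} [∀ r, Field (E r)]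
  [∀ r, Algebra F (E r)] [∀ r, Finite (E r)] {ι : ∀ r, E r →ₐ[F] AlgebraicClosure F}
  {ω : ∀ r, (E r)ˣ →* ℂˣ} {α β : Fin l → ℕ}

theorem ncard_fixed_eq (hω : IsCompatible ι ω) (u : ∀ r, (E r)ˣ)
    (hα : ∀ r, Nat.card (E r) = Nat.card F ^ α r) (hβ : ∀ r, β r ≤ α r) :
    ({Z : Submodule F (∀ r, E r) |
        (∀ r, Module.finrank F (graded Z r) = β r) ∧ u • Z = Z}.ncard : ℂ) =
      (∏ r, gaussSum (Nat.card F) (α r) (β r) (ω r (u r) : ℂ)) *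
        crossFactor (Nat.card F) α β fun r => (ω r (u r) : ℂ) := by
  let v : ∀ r, E r := fun r => u r
  let A := Algebra.adjoin F {v}
  let (r : Fin l) : Algebra A (E r) := ((Pi.evalRingHom E r).comp A.val.toRingHom).toAlgebra
  have (r : Fin l) : IsScalarTower F A (E r) := IsScalarTower.of_algebraMap_eq fun _ => rfl
  let g : A := ⟨v, Algebra.self_mem_adjoin_singleton F v⟩
  have hg : Algebra.adjoin F {g} = ⊤ := by
    have := Algebra.adjoin_adjoin_coe_preimage (R := F) (s := {v})
    convert this
    ext x
    simp [g, Subtype.ext_iff]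
  have hu : ∀ r, algebraMap A (E r) g = u r := fun _ => rfl
  -- As a subring of a product of fields, `A` is reduced; being also finite, it is semisimple.
  have : IsReduced A := isReduced_of_injective A.val Subtype.val_injective
  have : IsSemisimpleRing A := IsArtinianRing.isSemisimpleRing_of_isReduced A
  rw [ncard_fixed hg hu, card_submodule_graded_eq hω hg hu hα hβ]

variable {k : ℕ}

theorem exhibitsCSP_schubertUnion (b : ∀ r, Module.Basis (Fin (α r)) F (E r))
    (hω : IsCompatible ι ω) (hk : k ≤ ∑ r, α r)
    (hβk : ∑ r, β r = k) (hβ : ∀ r, β r ≤ α r) :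
    ExhibitsCSP ω (schubertUnion k b β) (sievingPolynomial α k (Nat.card F) β) where
  injective := hω.injective
  finite := Set.toFinite _
  stable := by
    rw [schubertUnion_eq hk hβk]
    intro u Z hZ r
    rw [finrank_graded_smul, hZ r]
  card_fixed := by
    intro u
    rw [schubertUnion_eq hk hβk]
    have h := map_sievingPolynomial hk hβk (Nat.card F)
      (MvPolynomial.aeval (R := ℤ) fun i => (ω i (u i) : ℂ)).toRingHom
    simp only [AlgHom.toRingHom_eq_coe, RingHom.coe_coe, MvPolynomial.aeval_X] at h
    rw [h, ← ncard_fixed_eq hω u (card_eq_pow_of_basis b) hβ]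
    rfl

theorem qBinomial_sum_eq (b : ∀ r, Module.Basis (Fin (α r)) F (E r))
    (ι : ∀ r, E r →ₐ[F] AlgebraicClosure F) :
    qBinomial (Nat.card F) (∑ r, α r) k =
      ∑ β ∈ (Finset.piAntidiag Finset.univ k).filter (fun β : Fin l → ℕ => ∀ r, β r ≤ α r),
        (∏ r, qBinomial (Nat.card F) (α r) (β r)) *
          ∏ r, ∏ s ∈ Finset.Ioi r, (Nat.card F : ℚ) ^ (β r * (α s - β s)) := by
  classical
  obtain ⟨ω, hω⟩ := exists_isCompatible ι
  have hq : 1 < Nat.card F := Finite.one_lt_card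
  have hfin : ∀ r, FiniteDimensional F (E r) := fun r => (b r).finiteDimensional_of_finite
  have hn : Module.finrank F (∀ r, E r) = ∑ r, α r := by
    rw [Module.finrank_pi_fintype]
    exact Finset.sum_congr rfl fun r _ => by
      rw [Module.finrank_eq_card_basis (b r), Fintype.card_fin]
  have hval : ∀ β : Fin l → ℕ, (∀ r, β r ≤ α r) →
      ({Z : Submodule F (∀ r, E r) | ∀ r, Module.finrank F (graded Z r) = β r}.ncard : ℚ) =
        (∏ r, qBinomial (Nat.card F) (α r) (β r)) *
          ∏ r, ∏ s ∈ Finset.Ioi r, (Nat.card F : ℚ) ^ (β r * (α s - β s)) := by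
    intro β hβ
    -- Every subspace is fixed by `u = 1`, so the fixed point formula gives the size of the whole
    -- stratum.
    have h := ncard_fixed_eq hω 1 (card_eq_pow_of_basis b) hβ
    simp only [one_smul, and_true, Pi.one_apply, map_one, Units.val_one, gaussSum_one hq,
      crossFactor, one_pow] at h
    have hq1 : qNumber (Nat.card F) (1 : ℂ) 1 = Nat.card F := by simp [qNumber]
    simp only [hq1, Finset.prod_const, Finset.card_range] at h
    have h' : ((({Z : Submodule F (∀ r, E r) |
        ∀ r, Module.finrank F (graded Z r) = β r}.ncard : ℚ) : ℚ) : ℂ) =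
        (((∏ r, qBinomial (Nat.card F) (α r) (β r)) *
          ∏ r, ∏ s ∈ Finset.Ioi r, (Nat.card F : ℚ) ^ (β r * (α s - β s)) : ℚ) : ℂ) := by
      push_cast
      rw [h]
      congr 1
      refine Finset.prod_congr rfl fun r _ => Finset.prod_congr rfl fun s _ => ?_
      rw [← pow_mul, mul_comm]
    exact_mod_cast h'
  rw [← hn, ← card_subspaces F (∀ r, E r) k]
  let B := (Finset.piAntidiag Finset.univ k).filter fun β : Fin l → ℕ => ∀ r, β r ≤ α r
  let e : {Z : Submodule F (∀ r, E r) // Module.finrank F Z = k} ≃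
      Σ β : B, {Z : Submodule F (∀ r, E r) | ∀ r, Module.finrank F (graded Z r) = β.1 r} :=
    { toFun := fun Z => ⟨⟨fun r => Module.finrank F (graded Z.1 r), by
          simp only [B, Finset.mem_filter, Finset.mem_piAntidiag, Finset.mem_univ, implies_true,
            and_true]
          refine ⟨(sum_finrank_graded b Z.1).trans Z.2, fun r => ?_⟩
          have := Submodule.finrank_le (graded Z.1 r)
          rwa [Module.finrank_eq_card_basis (b r), Fintype.card_fin] at this⟩,
        ⟨Z.1, fun _ => rfl⟩⟩
      invFun := fun p => ⟨p.2.1, by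
        have := p.1.2
        simp only [B, Finset.mem_filter, Finset.mem_piAntidiag] at this
        rw [← sum_finrank_graded b, ← this.1.1]
        exact Finset.sum_congr rfl fun r _ => p.2.2 r⟩
      left_inv := fun _ => rfl
      right_inv := fun p => Sigma.subtype_ext (Subtype.ext (funext p.2.2)) rfl }
  rw [Nat.card_congr e, Nat.card_sigma, Nat.cast_sum]
  simp only [Nat.card_coe_set_eq]
  rw [Finset.sum_coe_sort B fun β : Fin l → ℕ =>
    ({Z : Submodule F (∀ r, E r) | ∀ r, Module.finrank F (graded Z r) = β r}.ncard : ℚ)]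
  exact Finset.sum_congr rfl fun β hβ => hval β (Finset.mem_filter.1 hβ).2

end Main

end TorusSieving

end

theorem mainTheorem2 {F : Type*} [Field F] [Finite F] (q : ℕ) (hq : Nat.card F = q)
    (l : ℕ) (α : Fin l → ℕ) (k : ℕ) (hk : k ≤ ∑ r, α r)
    (E : Fin l → Type*) [∀ r, Field (E r)] [∀ r, Finite (E r)] [∀ r, Algebra F (E r)]
    (b : ∀ r, Module.Basis (Fin (α r)) F (E r))
    (ι : ∀ r, E r →ₐ[F] AlgebraicClosure F) :
    (∃ ω : ∀ r, (E r)ˣ →* ℂˣ, TorusSieving.IsCompatible ι ω) ∧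
    (∀ β : Fin l → ℕ, ∑ r, β r = k → (∀ r, β r ≤ α r) →
      (∀ ω : ∀ r, (E r)ˣ →* ℂˣ, TorusSieving.IsCompatible ι ω →
        TorusSieving.ExhibitsCSP ω (TorusSieving.schubertUnion k b β)
          (TorusSieving.sievingPolynomial α k q β)) ∧
      (∀ t : Fin l → FractionRing (MvPolynomial (Fin l) ℤ),
        (∀ r, t r = algebraMap (MvPolynomial (Fin l) ℤ) _ (MvPolynomial.X r)) →
        algebraMap (MvPolynomial (Fin l) ℤ) (FractionRing (MvPolynomial (Fin l) ℤ))
            (TorusSieving.sievingPolynomial α k q β) =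
          (∏ r, ∏ i ∈ Finset.range (β r),
            (t r ^ q ^ α r - t r ^ q ^ i) / (t r ^ q ^ β r - t r ^ q ^ i)) *
          ∏ r, ∏ s ∈ Finset.Ioi r, ∏ j ∈ Finset.range (β r), ∏ i ∈ Finset.range (α s - β s),
            TorusSieving.qNumber q (t r ^ q ^ (i + j)) (t s ^ q ^ (i + β r))) ∧
      ((MvPolynomial.eval (fun _ => (1 : ℤ)) (TorusSieving.sievingPolynomial α k q β) : ℤ) : ℚ) =
        (∏ r, TorusSieving.qBinomial q (α r) (β r)) *
          ∏ r, ∏ s ∈ Finset.Ioi r, (q : ℚ) ^ (β r * (α s - β s))) ∧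
    TorusSieving.qBinomial q (∑ r, α r) k =
      ∑ β ∈ (Finset.piAntidiag Finset.univ k).filter (fun β : Fin l → ℕ => ∀ r, β r ≤ α r),
        (∏ r, TorusSieving.qBinomial q (α r) (β r)) *
          ∏ r, ∏ s ∈ Finset.Ioi r, (q : ℚ) ^ (β r * (α s - β s)) := by
  subst hq
  have hq : 1 < Nat.card F := Finite.one_lt_card
  refine ⟨TorusSieving.exists_isCompatible ι, fun β hβk hβ => ⟨fun ω hω => ?_, fun t ht => ?_, ?_⟩,
    TorusSieving.qBinomial_sum_eq b ι⟩
  · exact TorusSieving.exhibitsCSP_schubertUnion b hω hk hβk hβ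
  · exact TorusSieving.map_sievingPolynomial_fractionRing hq hk hβk t ht
  · exact TorusSieving.map_sievingPolynomial_one hq hk hβk
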